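/- Let $H$ be a complex Hilbert space with inner product $\langle\cdot,\cdot\rangle$, antilinear in the first and linear in the second variable, and let $x\mapsto\bar x$ be a self-adjoint involution of $H$, i.e. a linear map with $\langle\bar x,y\rangle=\langle x,\bar y\rangle$ and $\bar{\bar x}=x$. Let $\alpha,q\in(-1,1)$. Let $\Sigma(n)$ be the group of bijections $\sigma$ of $\{\pm1,\dots,\pm n\}$ with $\sigma(-k)=-\sigma(k)$, generated by $\pi_0=(1,-1)$ and $\pi_i=(i,i+1)$ (acting also as $(-i,-(i+1))$), $1\le i\le n-1$. For $\sigma\in\Sigma(n)$ let $l_1(\sigma)$ be the number of factors $\pi_0$, and $l_2(\sigma)$ the number of factors $\pi_i$ with $i\ge1$, in an expression of $\sigma$ as a product of generators of minimal length (these numbers do not depend on the expression). The group $\Sigma(n)$ acts linearly on the algebraic tensor power $H^{\otimes n}$, where $\pi_0(x_1\otimes\cdots\otimes x_n)=\overline{x_1}\otimes x_2\otimes\cdots\otimes x_n$ and $\pi_i$, $i\ge1$, interchanges the factors $i$ and $i+1$. Let $\mathcal F=\bigoplus_{n\ge0}H^{\otimes n}$ be the algebraic full Fock space (finite sums, no completion;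 $H^{\otimes0}=\mathbb C\Omega$), let $\langle\cdot,\cdot\rangle_{0,0}$ be the form on $\mathcal F$ with $\langle x_1\otimes\cdots\otimes x_m,y_1\otimes\cdots\otimes y_n\rangle_{0,0}=\delta_{m,n}\prod_{i=1}^n\langle x_i,y_i\rangle$, and put, with $0^0=1$, $$P^{(n)}_{\alpha,q}=\sum_{\sigma\in\Sigma(n)}\alpha^{l_1(\sigma)}q^{l_2(\sigma)}\,\sigma,\qquad \langle f,g\rangle_{\alpha,q}=\sum_{n\ge0}\langle f_n,P^{(n)}_{\alpha,q}g_n\rangle_{0,0},$$ where $f_n,g_n$ are the components of $f,g\in\mathcal F$ in $H^{\otimes n}$. For $x\in H$ let $b^*(x)$ be the linear operator on $\mathcal F$ with $b^*(x)(x_1\otimes\cdots\otimes x_n)=x_1\otimes\cdots\otimes x_n\otimes x$ and $b^*(x)\Omega=x$. Then for every $x\in H$ the operator $b^*(x)$ has exactly one adjoint with respect to $\langle\cdot,\cdot\rangle_{\alpha,q}$, i.e. there is exactly one linear operator $b(x)$ on $\mathcal F$ with $\langle b^*(x)f,g\rangle_{\alpha,q}=\langle f,b(x)g\rangle_{\alpha,q}$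 for all $f,g\in\mathcal F$; and for all $x,y\in H$ $$b(x)b^*(y)-q\,b^*(y)b(x)=\langle x,y\rangle\,I+\alpha\,\langle x,\bar y\rangle\,q^{2N},$$ where $N$ is the number operator, $Nf=nf$ for $f\in H^{\otimes n}$, so that $q^{2N}f=q^{2n}f$ for $f\in H^{\otimes n}$. -/

import Mathlib

open scoped TensorProduct DirectSum

noncomputable section

namespace TypeBFock

/-! ### The Coxeter group of type B -/

/-- The map `k ↦ -k` on the `2n` points `±1, …, ±n`; the point `s · (k + 1)`, with `s = ±1`, is
represented by the pair `(k, s)` in `Fin n × ℤˣ`. -/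
def opp {n : ℕ} (p : Fin n × ℤˣ) : Fin n × ℤˣ := (p.1, -p.2)

/-- The hyperoctahedral group `Σ(n)`: all bijections `σ` of `{±1, …, ±n}` with
`σ (-k) = -σ k`, under composition. -/
def hyperoctahedral (n : ℕ) : Subgroup (Equiv.Perm (Fin n × ℤˣ)) where
  carrier := {σ | ∀ p, σ (opp p) = opp (σ p)}
  one_mem' := fun _ => rfl
  mul_mem' := by
    intro σ τ hσ hτ p
    change ∀ p, σ (opp p) = opp (σ p) at hσ
    change ∀ p, τ (opp p) = opp (τ p) at hτ
    simp only [Equiv.Perm.mul_apply, hτ, hσ]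
  inv_mem' := by
    intro σ hσ p
    change ∀ p, σ (opp p) = opp (σ p) at hσ
    rw [Equiv.Perm.inv_eq_iff_eq, hσ]
    exact congrArg opp (σ.apply_symm_apply p).symm

instance hyperoctahedralFintype (n : ℕ) : Fintype (hyperoctahedral n) := Fintype.ofFinite _

theorem swap_sign_mem {n : ℕ} (i : Fin n) :
    Equiv.swap ((i, 1) : Fin n × ℤˣ) (i, -1) ∈ hyperoctahedral n := by
  rintro ⟨k, s⟩
  rcases Int.units_eq_one_or s with rfl | rfl <;>
    by_cases h : k = i <;> simp [opp, Equiv.swap_apply_def, h]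

theorem perm_mem {n : ℕ} (e : Equiv.Perm (Fin n)) :
    e.prodCongr (Equiv.refl ℤˣ) ∈ hyperoctahedral n := fun _ => rfl

/-- The Coxeter generators: `gen 0` is `π₀ = (1, -1)`, and `gen i` with `1 ≤ i ≤ n - 1` is
`πᵢ = (i, i + 1)` (together with `(-i, -(i + 1))`), that is, the transposition of the positions
`i - 1` and `i` when positions are counted from `0`. -/
def gen {n : ℕ} (i : Fin n) : hyperoctahedral n :=
  if i.val = 0 then ⟨Equiv.swap (i, 1) (i, -1), swap_sign_mem i⟩
  else ⟨(Equiv.swap (⟨i.val - 1, by omega⟩ : Fin n) i).prodCongr (Equiv.refl ℤˣ), perm_mem _⟩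

/-- `w` is an irreducible form of `σ`: an expression of `σ` as a product of generators of minimal
length. -/
def IsIrreducibleForm {n : ℕ} (w : List (Fin n)) (σ : hyperoctahedral n) : Prop :=
  (w.map gen).prod = σ ∧ ∀ w' : List (Fin n), (w'.map gen).prod = σ → w.length ≤ w'.length

/-- `l₁(σ)`: the number of letters `π₀` in an irreducible form of `σ`. (This number is the same for
all irreducible forms, so the infimum is over a one-element set.) -/
def l₁ {n : ℕ} (σ : hyperoctahedral n) : ℕ :=
  sInf {m | ∃ w : List (Fin n), IsIrreducibleForm w σ ∧ m = w.countP (fun i => i.val = 0)}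

/-- `l₂(σ)`: the number of letters `πᵢ`, `1 ≤ i ≤ n - 1`, in an irreducible form of `σ`. (This
number is the same for all irreducible forms, so the infimum is over a one-element set.) -/
def l₂ {n : ℕ} (σ : hyperoctahedral n) : ℕ :=
  sInf {m | ∃ w : List (Fin n), IsIrreducibleForm w σ ∧ m = w.countP (fun i => i.val ≠ 0)}

/-! ### The action on tensor powers -/

/-- The permutation `k ↦ |σ(k)|` of the `n` positions. -/
def absPerm {n : ℕ} (σ : hyperoctahedral n) : Equiv.Perm (Fin n) where
  toFun k := (σ.1 (k, 1)).1
  invFun k := (σ.1⁻¹ (k, 1)).1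
  left_inv k := by
    have h := (hyperoctahedral n).inv_mem σ.2
    have h1 : ∀ p, (σ.1⁻¹ (p.1, 1)).1 = (σ.1⁻¹ p).1 := by
      rintro ⟨k, s⟩
      rcases Int.units_eq_one_or s with rfl | rfl
      · rfl
      · exact (congrArg Prod.fst (h (k, 1))).symm
    refine (h1 _).trans ?_
    exact congrArg Prod.fst (σ.1.symm_apply_apply (k, 1))
  right_inv k := by
    have h1 : ∀ p, (σ.1 (p.1, 1)).1 = (σ.1 p).1 := by
      rintro ⟨k, s⟩
      rcases Int.units_eq_one_or s with rfl | rfl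
      · rfl
      · exact (congrArg Prod.fst (σ.2 (k, 1))).symm
    refine (h1 _).trans ?_
    exact congrArg Prod.fst (σ.1.apply_symm_apply (k, 1))

variable {H : Type*} [NormedAddCommGroup H] [InnerProductSpace ℂ H]

/-- The action of `σ ∈ Σ(n)` on the algebraic tensor power `H^{⊗n}`, where `J x = x̄`. With the
convention `x₋ₖ = x̄ₖ`, it sends `x₁ ⊗ ⋯ ⊗ xₙ` to the tensor whose `k`-th factor is `x_{σ⁻¹(k)}`. -/
def act (J : H →ₗ[ℂ] H) {n : ℕ} (σ : hyperoctahedral n) : (⨂[ℂ]^n H) →ₗ[ℂ] (⨂[ℂ]^n H) :=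
  PiTensorProduct.map (fun k => if (σ.1⁻¹ (k, 1)).2 = 1 then LinearMap.id else J) ∘ₗ
    (PiTensorProduct.reindex ℂ (fun _ : Fin n => H) (absPerm σ)).toLinearMap

theorem act_tprod (J : H →ₗ[ℂ] H) {n : ℕ} (σ : hyperoctahedral n) (x : Fin n → H) :
    act J σ (PiTensorProduct.tprod ℂ x) = PiTensorProduct.tprod ℂ (fun k =>
      if (σ.1⁻¹ (k, 1)).2 = 1 then x (σ.1⁻¹ (k, 1)).1 else J (x (σ.1⁻¹ (k, 1)).1)) := by
  simp only [act, LinearMap.comp_apply, LinearEquiv.coe_coe, PiTensorProduct.reindex_tprod,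
    PiTensorProduct.map_tprod]
  congr 1
  funext k
  split_ifs <;> rfl

theorem act_one (J : H →ₗ[ℂ] H) {n : ℕ} :
    act J (1 : hyperoctahedral n) = LinearMap.id := by
  refine PiTensorProduct.ext (MultilinearMap.ext fun x => ?_)
  simp [act_tprod]

theorem act_mul (J : H →ₗ[ℂ] H) (hJ : ∀ x, J (J x) = x) {n : ℕ} (σ τ : hyperoctahedral n) :
    act J (σ * τ) = act J σ ∘ₗ act J τ := by
  refine PiTensorProduct.ext (MultilinearMap.ext fun x => ?_)
  simp only [LinearMap.compMultilinearMap_apply, LinearMap.comp_apply, act_tprod]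
  congr 1
  funext k
  have hτ := (hyperoctahedral n).inv_mem τ.2
  have e : ((σ * τ : hyperoctahedral n).1)⁻¹ (k, 1) = τ.1⁻¹ (σ.1⁻¹ (k, 1)) := by
    simp [mul_inv_rev]
  rw [e]
  obtain ⟨j, s⟩ := σ.1⁻¹ (k, 1)
  rcases Int.units_eq_one_or s with rfl | rfl
  · simp
  · have h : τ.1⁻¹ (j, -1) = opp (τ.1⁻¹ (j, 1)) := hτ (j, 1)
    rw [h]
    obtain ⟨i, t⟩ := τ.1⁻¹ (j, 1)
    rcases Int.units_eq_one_or t with rfl | rfl <;> simp [opp, hJ]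

/-- `π₀` sends `x₁ ⊗ x₂ ⊗ ⋯ ⊗ xₙ` to `x̄₁ ⊗ x₂ ⊗ ⋯ ⊗ xₙ`. -/
theorem act_gen_zero (J : H →ₗ[ℂ] H) {n : ℕ} (i : Fin n) (hi : i.val = 0) (x : Fin n → H) :
    act J (gen i) (PiTensorProduct.tprod ℂ x) =
      PiTensorProduct.tprod ℂ (Function.update x i (J (x i))) := by
  rw [act_tprod]
  congr 1
  funext k
  by_cases h : k = i
  · subst h
    simp [gen, hi]
  · simp [gen, hi, h, Equiv.swap_apply_def]

/-- `πᵢ` with `i ≥ 1` interchanges two neighbouring factors. -/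
theorem act_gen_pos (J : H →ₗ[ℂ] H) {n : ℕ} (i : Fin n) (hi : i.val ≠ 0) (x : Fin n → H) :
    act J (gen i) (PiTensorProduct.tprod ℂ x) =
      PiTensorProduct.tprod ℂ
        (fun k => x (Equiv.swap (⟨i.val - 1, by omega⟩ : Fin n) i k)) := by
  rw [act_tprod]
  congr 1
  funext k
  have e : (gen i).1⁻¹ (k, 1) = (Equiv.swap (⟨i.val - 1, by omega⟩ : Fin n) i k, 1) := by
    rw [Equiv.Perm.inv_eq_iff_eq]
    simp [gen, hi]
  simp [e]

/-! ### The Fock space and its inner products -/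

/-- The algebraic full Fock space `⨁ₙ H^{⊗n}` (algebraic tensor powers, finite sums). -/
abbrev Fock (H : Type*) [NormedAddCommGroup H] [InnerProductSpace ℂ H] : Type _ :=
  ⨁ n : ℕ, ⨂[ℂ]^n H

/-- The multilinear map `y ↦ ∏ᵢ ⟨xᵢ, yᵢ⟩`. -/
def prodInner {n : ℕ} (x : Fin n → H) : MultilinearMap ℂ (fun _ : Fin n => H) ℂ :=
  (MultilinearMap.mkPiAlgebra ℂ (Fin n) ℂ).compLinearMap (fun i => (innerSL ℂ (x i)).toLinearMap)

theorem prodInner_apply {n : ℕ} (x y : Fin n → H) :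
    prodInner x y = ∏ i, inner ℂ (x i) (y i) := by
  simp [prodInner]

/-- For fixed `y`, the antilinear functional `s ↦ ⟨s, y₁ ⊗ ⋯ ⊗ yₙ⟩`, the complex conjugate of
`s ↦ ⟨y₁ ⊗ ⋯ ⊗ yₙ, s⟩`. -/
def innerTensorAux {n : ℕ} (y : Fin n → H) : (⨂[ℂ]^n H) →ₗ⋆[ℂ] ℂ :=
  (starLinearEquiv ℂ (A := ℂ)).toLinearMap.comp (PiTensorProduct.lift (prodInner y))

theorem innerTensorAux_tprod {n : ℕ} (y x : Fin n → H) :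
    innerTensorAux y (PiTensorProduct.tprod ℂ x) = prodInner x y := by
  simp [innerTensorAux, prodInner_apply]

theorem antilinear_ext {n : ℕ} {f g : (⨂[ℂ]^n H) →ₗ⋆[ℂ] ℂ}
    (h : ∀ x : Fin n → H, f (PiTensorProduct.tprod ℂ x) = g (PiTensorProduct.tprod ℂ x)) :
    f = g := by
  refine LinearMap.ext fun s => ?_
  induction s using PiTensorProduct.induction_on with
  | smul_tprod r x => rw [map_smulₛₗ, map_smulₛₗ, h]
  | add s t hs ht => rw [map_add, map_add, hs, ht]

/-- The sesquilinear form on `H^{⊗n}`, antilinear in the first variable, with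
`⟨x₁ ⊗ ⋯ ⊗ xₙ, y₁ ⊗ ⋯ ⊗ yₙ⟩ = ∏ᵢ ⟨xᵢ, yᵢ⟩`. -/
def innerTensor (n : ℕ) : (⨂[ℂ]^n H) →ₗ⋆[ℂ] (⨂[ℂ]^n H) →ₗ[ℂ] ℂ :=
  LinearMap.flip (PiTensorProduct.lift
    { toFun := fun y : Fin n → H => innerTensorAux y
      map_update_add' := fun y i a b => antilinear_ext fun x => by
        simp only [LinearMap.add_apply, innerTensorAux_tprod, MultilinearMap.map_update_add]
      map_update_smul' := fun y i c a => antilinear_ext fun x => by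
        simp only [LinearMap.smul_apply, innerTensorAux_tprod, MultilinearMap.map_update_smul] })

theorem innerTensor_tprod {n : ℕ} (x y : Fin n → H) :
    innerTensor n (PiTensorProduct.tprod ℂ x) (PiTensorProduct.tprod ℂ y) =
      ∏ i, inner ℂ (x i) (y i) := by
  simp [innerTensor, LinearMap.flip_apply, innerTensorAux_tprod, prodInner_apply]

/-- The type B symmetrization operator
`P^{(n)}_{α,q} = ∑_{σ ∈ Σ(n)} α^{l₁(σ)} q^{l₂(σ)} σ` on `H^{⊗n}` (it is the identity for
`n = 0`). -/
def symmetrization (α q : ℝ) (J : H →ₗ[ℂ] H) (n : ℕ) : (⨂[ℂ]^n H) →ₗ[ℂ] (⨂[ℂ]^n H) :=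
  ∑ σ : hyperoctahedral n, ((α : ℂ) ^ l₁ σ * (q : ℂ) ^ l₂ σ) • act J σ

/-- The deformed inner product `⟨f, g⟩_{α,q} = ∑ₙ ⟨fₙ, P^{(n)}_{α,q} gₙ⟩_{0,0}` on the Fock
space. -/
def innerFock (α q : ℝ) (J : H →ₗ[ℂ] H) (f g : Fock H) : ℂ :=
  DirectSum.toModule ℂ ℕ ℂ (fun n => innerTensor n (f n) ∘ₗ symmetrization α q J n) g

/-! ### Creation, annihilation and number operators -/

/-- The map `x₁ ⊗ ⋯ ⊗ xₙ ↦ x₁ ⊗ ⋯ ⊗ xₙ ⊗ x` from `H^{⊗n}` to `H^{⊗(n+1)}`. -/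
def appendRight (x : H) (n : ℕ) : (⨂[ℂ]^n H) →ₗ[ℂ] (⨂[ℂ]^(n + 1) H) :=
  (PiTensorProduct.lift
    (MultilinearMap.curryRight (PiTensorProduct.tprod ℂ (s := fun _ : Fin (n + 1) => H)))).flip x

theorem appendRight_tprod (x : H) (n : ℕ) (v : Fin n → H) :
    appendRight x n (PiTensorProduct.tprod ℂ v) =
      PiTensorProduct.tprod ℂ (Fin.snoc (α := fun _ => H) v x) := by
  simp [appendRight, LinearMap.flip_apply]

/-- The creation operator `b*(x)`: on every `H^{⊗n}` it appends `x` on the right. -/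
def creation (x : H) : Fock H →ₗ[ℂ] Fock H :=
  DirectSum.toModule ℂ ℕ (Fock H) fun n =>
    DirectSum.lof ℂ ℕ (fun m : ℕ => ⨂[ℂ]^m H) (n + 1) ∘ₗ appendRight x n

/-- `b` is the annihilation operator `b(x)`: an adjoint of `b*(x)` with respect to
`⟨·,·⟩_{α,q}`. -/
def IsAnnihilation (α q : ℝ) (J : H →ₗ[ℂ] H) (x : H) (b : Fock H →ₗ[ℂ] Fock H) : Prop :=
  ∀ f g : Fock H, innerFock α q J (creation x f) g = innerFock α q J f (b g)

/-- The function `φ(N)` of the number operator `N`: multiplication by `φ n` on `H^{⊗n}`. In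
particular `N` itself is the case `φ n = n`. -/
def functionOfNumber (φ : ℕ → ℂ) : Fock H →ₗ[ℂ] Fock H :=
  DirectSum.lmap fun n => φ n • (LinearMap.id : (⨂[ℂ]^n H) →ₗ[ℂ] (⨂[ℂ]^n H))

/-- The operator `q^{2N}`, with `q^{2N} f = q^{2n} f` for `f ∈ H^{⊗n}` (and `0⁰ = 1`). -/
def qPowTwoN (q : ℝ) : Fock H →ₗ[ℂ] Fock H := functionOfNumber fun n => (q : ℂ) ^ (2 * n)

end TypeBFock

end

/-! Let `R_n` in the group algebra of `Σ(n+1)` be the sum, weighted by `α^{l₁} q^{l₂}`, of the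
minimal representatives of the cosets of `Σ(n)`, the stabilizer of the last point. Both lengths add
along the factorization over cosets, so `P^{(n+1)} = P^{(n)} R_n` (`symElement_succ`). Contraction
`C_x` of the last tensor factor against `x` is the adjoint of `b*(x)` for the undeformed form and
commutes with `Σ(n)`. Therefore `C_x P^{(n+1)} = P^{(n)} C_x R_n`, and `b(x) = C_x R_n` is an
adjoint of `b*(x)` for the deformed form.

The relation follows from the recursion `R_n = 1 + q π_n R_{n-1} + α q^{2n} τ`, where `τ` applies
the involution to the last factor (`cosetElement_succ`). When it is applied to `h ⊗ y` and
contracted with `x`, its three terms give `⟨x,y⟩ h`, `q b*(y) b(x) h` and `α q^{2n} ⟨x,ȳ⟩ h`.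

Uniqueness of the adjoint is nondegeneracy of the deformed form: the undeformed form is
nondegenerate on algebraic tensors (`innerTensor_nondegenerate`), and `P^{(n)}` is invertible
because every `R_n` is a unit. In type A, Zagier's telescoping identity expresses the coset sum
through factors `1 - c g` with `|c| < 1` and `g` in the group; these are units since `g` has finite
order. In type B, multiplying `R_n` on the left by a type A symmetrizer turns it into one such
factor times a larger type A symmetrizer (`symA_mul_cosetSum`), so `R_n` is a unit as well. -/

namespace TypeBFock

noncomputable section

/-! ### Symmetrizers in algebras with braid relations -/

section Braid

variable {A : Type*} [Ring A]

/-- The product `s (m - 1) ⋯ s 1 s 0`. -/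
def cyc (s : ℕ → A) : ℕ → A
  | 0 => 1
  | m + 1 => s m * cyc s m

/-- The product `s 0 s 1 ⋯ s (m - 1)`. -/
def cocyc (s : ℕ → A) : ℕ → A
  | 0 => 1
  | m + 1 => cocyc s m * s m

/-- The type A braid relations among `s 0, …, s (N - 1)`. -/
structure IsBraid (s : ℕ → A) (N : ℕ) : Prop where
  braid : ∀ i, i + 1 < N → s i * s (i + 1) * s i = s (i + 1) * s i * s (i + 1)
  comm : ∀ i j, i + 1 < j → j < N → s i * s j = s j * s i

theorem IsBraid.mono {s : ℕ → A} {N M : ℕ} (h : IsBraid s N) (hM : M ≤ N) : IsBraid s M :=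
  ⟨fun i hi => h.braid i (by omega), fun i j hi hj => h.comm i j hi (by omega)⟩

theorem IsBraid.shift {s : ℕ → A} {N : ℕ} (h : IsBraid s (N + 1)) :
    IsBraid (fun i => s (i + 1)) N :=
  ⟨fun i hi => h.braid (i + 1) (by omega), fun i j hi hj => h.comm _ _ (by omega) (by omega)⟩

theorem cyc_comm {s : ℕ → A} {g : A} {m : ℕ} (h : ∀ i < m, s i * g = g * s i) :
    cyc s m * g = g * cyc s m := by
  induction m with
  | zero => simp [cyc]
  | succ m ih =>
    rw [cyc, mul_assoc, ih fun i hi => h i (by omega), ← mul_assoc, h m (by omega), mul_assoc]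

theorem cocyc_comm {s : ℕ → A} {g : A} {m : ℕ} (h : ∀ i < m, s i * g = g * s i) :
    cocyc s m * g = g * cocyc s m := by
  induction m with
  | zero => simp [cocyc]
  | succ m ih =>
    rw [cocyc, mul_assoc, h m (by omega), ← mul_assoc, ih fun i hi => h i (by omega), mul_assoc]

/-- The letter `s i` commutes past the letters above `s (i + 1)`, the braid relation turns `s i * s
(i + 1) * s i` into `s (i + 1) * s i * s (i + 1)`, and the new `s (i + 1)` commutes past the
remaining lower letters. -/
theorem cyc_shift {s : ℕ → A} {m i : ℕ} (h : IsBraid s m) (hi : i + 1 < m) :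
    s i * cyc s m = cyc s m * s (i + 1) := by
  induction m with
  | zero => omega
  | succ m ih =>
    rcases Nat.lt_or_ge (i + 1) m with h1 | h1
    · rw [cyc, ← mul_assoc, h.comm i m h1 (by omega), mul_assoc, ih (h.mono (by omega)) h1,
        mul_assoc]
    · obtain rfl : m = i + 1 := by omega
      have h2 : cyc s i * s (i + 1) = s (i + 1) * cyc s i :=
        cyc_comm fun j hj => h.comm j (i + 1) (by omega) (by omega)
      rw [cyc, cyc, mul_assoc, mul_assoc, h2, ← mul_assoc, ← mul_assoc, h.braid i (by omega)]
      simp only [mul_assoc]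

theorem cocyc_shift {s : ℕ → A} {m i : ℕ} (h : IsBraid s m) (hi : i + 1 < m) :
    s (i + 1) * cocyc s m = cocyc s m * s i := by
  induction m with
  | zero => omega
  | succ m ih =>
    rcases Nat.lt_or_ge (i + 1) m with h1 | h1
    · rw [cocyc, ← mul_assoc, ih (h.mono (by omega)) h1, mul_assoc, mul_assoc,
        h.comm i m h1 (by omega)]
    · obtain rfl : m = i + 1 := by omega
      have h2 : cocyc s i * s (i + 1) = s (i + 1) * cocyc s i :=
        cocyc_comm fun j hj => h.comm j (i + 1) (by omega) (by omega)
      rw [cocyc, cocyc, ← mul_assoc, ← mul_assoc, ← h2, mul_assoc, mul_assoc, ← mul_assoc (s _),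
        ← h.braid i (by omega)]
      simp only [mul_assoc]

variable [Algebra ℂ A]

/-- The sum `∑ₖ q ^ k s (m - 1) ⋯ s (m - k)` over `0 ≤ k ≤ m`. -/
def cycSum (q : ℂ) (s : ℕ → A) : ℕ → A
  | 0 => 1
  | m + 1 => 1 + q • (s m * cycSum q s m)

/-- The sum `∑ₖ q ^ k s 0 ⋯ s (k - 1)` over `0 ≤ k ≤ m`. -/
def cocycSum (q : ℂ) (s : ℕ → A) : ℕ → A
  | 0 => 1
  | m + 1 => cocycSum q s m + q ^ (m + 1) • cocyc s (m + 1)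

/-- The type A symmetrizer, as a product of the elements `cycSum`. -/
def symA (q : ℂ) (s : ℕ → A) : ℕ → A
  | 0 => 1
  | m + 1 => symA q s m * cycSum q s (m + 1)

/-- The weighted sum over the minimal coset representatives of `Σ(m) ⊆ Σ(m + 1)`, where `z` plays
the role of `π₀` and `s i` that of `πᵢ₊₁`. -/
def cosetSum (α q : ℂ) (z : A) (s : ℕ → A) : ℕ → A
  | 0 => 1 + α • z
  | m + 1 => 1 + q • (s m * cosetSum α q z s m) +
      (α * q ^ (2 * (m + 1))) • (cyc s (m + 1) * z * cocyc s (m + 1))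

/-! ### Factorizations of the weighted sums -/

theorem cocycSum_comm (q : ℂ) {s : ℕ → A} {g : A} {m : ℕ} (h : ∀ i < m, s i * g = g * s i) :
    cocycSum q s m * g = g * cocycSum q s m := by
  induction m with
  | zero => simp [cocycSum]
  | succ m ih =>
    rw [cocycSum, add_mul, mul_add, ih fun i hi => h i (by omega), smul_mul_assoc, mul_smul_comm,
      cocyc_comm h]

/-- Two sequences are allowed because the elements `g` of interest, `cyc` and `cocyc`, shift the
index of the letters they pass. -/
theorem cycSum_intertwine (q : ℂ) {s s' : ℕ → A} {g : A} {m : ℕ}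
    (h : ∀ i < m, s i * g = g * s' i) : cycSum q s m * g = g * cycSum q s' m := by
  induction m with
  | zero => simp [cycSum]
  | succ m ih =>
    rw [cycSum, cycSum, add_mul, mul_add, one_mul, mul_one, smul_mul_assoc, mul_smul_comm,
      mul_assoc, ih fun i hi => h i (by omega), ← mul_assoc, h m (by omega), mul_assoc]

theorem symA_intertwine (q : ℂ) {s s' : ℕ → A} {g : A} {m : ℕ}
    (h : ∀ i < m, s i * g = g * s' i) : symA q s m * g = g * symA q s' m := by
  induction m with
  | zero => simp [symA]
  | succ m ih =>
    rw [symA, symA, mul_assoc, cycSum_intertwine q h, ← mul_assoc,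
      ih fun i hi => h i (by omega), mul_assoc]

/-- Only the longest product in the sum contains the letter `s 0`; removing it leaves the sum for
the shifted sequence. -/
theorem cycSum_succ (q : ℂ) (s : ℕ → A) (m : ℕ) :
    cycSum q s (m + 1) = cycSum q (fun i => s (i + 1)) m + q ^ (m + 1) • cyc s (m + 1) := by
  induction m with
  | zero => simp [cycSum, cyc]
  | succ m ih =>
    rw [cycSum, ih, mul_add, smul_add, ← add_assoc, mul_smul_comm, smul_smul, ← pow_succ',
      cycSum, cyc, cyc, cyc]

/-- Zagier's telescoping identity. -/
theorem cycSum_mul_one_sub (q : ℂ) {s : ℕ → A} {m : ℕ} (h : IsBraid s (m + 1)) :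
    cycSum q s (m + 1) * (1 - q ^ (m + 1) • cyc s (m + 1)) =
      (1 - q ^ (m + 2) • (s m * cyc s (m + 1))) * cycSum q (fun i => s (i + 1)) m := by
  have h1 : cycSum q s (m + 1) * cyc s (m + 1) = cyc s (m + 1) +
      q • (s m * cyc s (m + 1) * cycSum q (fun i => s (i + 1)) m) := by
    rw [cycSum, add_mul, one_mul, smul_mul_assoc, mul_assoc, mul_assoc,
      cycSum_intertwine q fun i hi => cyc_shift h (by omega)]
  rw [mul_sub, mul_one, mul_smul_comm, h1, cycSum_succ, sub_mul, one_mul, smul_mul_assoc, smul_add,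
    smul_smul, ← pow_succ]
  abel

theorem cycSum_shift_mul_cocycSum (q : ℂ) {s : ℕ → A} {m : ℕ} (h : IsBraid s (m + 1)) :
    cycSum q (fun i => s (i + 1)) m * cocycSum q s (m + 1) =
      cocycSum q s m * cycSum q s (m + 1) := by
  induction m with
  | zero => simp [cycSum, cocycSum, cocyc]
  | succ m ih =>
    have h1 : cycSum q (fun i => s (i + 1)) (m + 1) * cocyc s (m + 2) =
        cocyc s (m + 2) * cycSum q s (m + 1) :=
      cycSum_intertwine q fun i hi => cocyc_shift h (by omega)
    have h2 : cocycSum q s m * s (m + 1) = s (m + 1) * cocycSum q s m :=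
      cocycSum_comm q fun j hj => h.comm j (m + 1) (by omega) (by omega)
    have h3 : cycSum q (fun i => s (i + 1)) (m + 1) * cocycSum q s (m + 1) =
        cocycSum q s (m + 1) +
          q • (cocycSum q s m * (s (m + 1) * cycSum q s (m + 1))) := by
      rw [cycSum, add_mul, one_mul, smul_mul_assoc, mul_assoc, ih (h.mono (by omega)),
        ← mul_assoc, ← mul_assoc, h2]
    have h4 : cocycSum q s (m + 1) * (s (m + 1) * cycSum q s (m + 1)) =
        cocycSum q s m * (s (m + 1) * cycSum q s (m + 1)) +
          q ^ (m + 1) • (cocyc s (m + 2) * cycSum q s (m + 1)) := by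
      rw [cocycSum, add_mul, smul_mul_assoc, ← mul_assoc (cocyc s (m + 1)), ← cocyc]
    rw [cocycSum, mul_add, mul_smul_comm, h1, h3, cycSum.eq_2 q s (m + 1), mul_add, mul_one,
      mul_smul_comm, h4, smul_add, smul_smul, ← pow_succ', add_assoc]

/-- The symmetrizer can be factored over the subgroup omitting the first generator as well as over
the one omitting the last. The induction exchanges the two kinds of coset sums by
`cycSum_shift_mul_cocycSum`. -/
theorem symA_shift_mul_cocycSum (q : ℂ) {s : ℕ → A} {m : ℕ} (h : IsBraid s (m + 1)) :
    symA q (fun i => s (i + 1)) m * cocycSum q s (m + 1) = symA q s (m + 1) := by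
  induction m with
  | zero => simp [symA, cycSum, cocycSum, cocyc]
  | succ m ih =>
    rw [symA, mul_assoc, cycSum_shift_mul_cocycSum q h, ← mul_assoc, ih (h.mono (by omega)),
      symA.eq_2 q s (m + 1)]

/-- A representative without sign change is a descending product. One with a sign change descends
all the way by `cyc s m`, passes `z`, and ascends by some `cocyc s k`. -/
theorem cosetSum_eq (α q : ℂ) (z : A) (s : ℕ → A) (m : ℕ) :
    cosetSum α q z s m = cycSum q s m + (α * q ^ m) • (cyc s m * z * cocycSum q s m) := by
  induction m with
  | zero => simp [cosetSum, cycSum, cocycSum, cyc]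
  | succ m ih =>
    rw [cosetSum, ih, cycSum, cocycSum, cyc]
    simp only [mul_add, smul_add, mul_smul_comm, smul_smul, mul_assoc, add_assoc]
    congr 3
    · congr 1
      ring
    · congr 1
      ring

/-- Moving `symA q s m` to the right past `cyc s (m + 1)` shifts its letters to `s 1, …, s m`, which
commute with `z`. On the far side it merges with the ascending sum into the full symmetrizer, which
the descending part produces too, so it factors out on the right. -/
theorem symA_mul_cosetSum (α q : ℂ) {z : A} {s : ℕ → A} {m : ℕ} (h : IsBraid s (m + 1))
    (hz : ∀ i, 1 ≤ i → i ≤ m → s i * z = z * s i) :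
    symA q s m * cosetSum α q z s (m + 1) =
      (1 + (α * q ^ (m + 1)) • (cyc s (m + 1) * z)) * symA q s (m + 1) := by
  have h1 : symA q s m * (cyc s (m + 1) * z) =
      cyc s (m + 1) * z * symA q (fun i => s (i + 1)) m :=
    symA_intertwine q fun i hi => by
      rw [← mul_assoc, cyc_shift h (by omega), mul_assoc, hz _ (by omega) (by omega), mul_assoc]
  rw [cosetSum_eq, mul_add, mul_smul_comm, ← mul_assoc (symA q s m) (_ * z), h1, mul_assoc,
    symA_shift_mul_cocycSum q h, add_mul, one_mul, smul_mul_assoc, ← symA]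

/-- The telescoping identity reduces the claim to the shifted sequence with one letter fewer, up to
two factors `1 - c • g`. The induction therefore runs over all sequences `s`. -/
theorem isUnit_cycSum {q : ℂ} (hq : ‖q‖ < 1) {s : ℕ → A} {m : ℕ} (h : IsBraid s m)
    (hs : ∀ g ∈ Submonoid.closure (Set.range s), ∀ c : ℂ, ‖c‖ < 1 → IsUnit (1 - c • g)) :
    IsUnit (cycSum q s m) := by
  induction m generalizing s with
  | zero => simp [cycSum]
  | succ m ih =>
    have hmem : ∀ i, s i ∈ Submonoid.closure (Set.range s) := fun i =>
      Submonoid.subset_closure ⟨i, rfl⟩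
    have hcyc : ∀ k, cyc s k ∈ Submonoid.closure (Set.range s) := fun k => by
      induction k with
      | zero => exact one_mem _
      | succ k ihk => exact mul_mem (hmem k) ihk
    have hn : ∀ k, ‖q ^ (k + 1)‖ < 1 := fun k => by
      rw [norm_pow]
      exact pow_lt_one₀ (norm_nonneg q) hq (by omega)
    have h1 := hs _ (hcyc (m + 1)) _ (hn m)
    have h2 := hs _ (mul_mem (hmem m) (hcyc (m + 1))) _ (hn (m + 1))
    have h3 : IsUnit (cycSum q (fun i => s (i + 1)) m) :=
      ih h.shift fun g hg => hs g (Submonoid.closure_mono (by rintro _ ⟨i, rfl⟩; exact ⟨_, rfl⟩) hg)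
    rw [← h1.unit.isUnit_mul_units] 
    exact cycSum_mul_one_sub q h ▸ h2.mul h3

theorem isUnit_symA {q : ℂ} (hq : ‖q‖ < 1) {s : ℕ → A} {m : ℕ} (h : IsBraid s m)
    (hs : ∀ g ∈ Submonoid.closure (Set.range s), ∀ c : ℂ, ‖c‖ < 1 → IsUnit (1 - c • g)) :
    IsUnit (symA q s m) := by
  induction m with
  | zero => simp [symA]
  | succ m ih => exact (ih (h.mono (by omega))).mul (isUnit_cycSum hq h hs)

theorem isUnit_cosetSum {α q : ℂ} (hα : ‖α‖ < 1) (hq : ‖q‖ < 1) {z : A} {s : ℕ → A} {m : ℕ}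
    (h : IsBraid s m) (hz : ∀ i, 1 ≤ i → i < m → s i * z = z * s i)
    (hs : ∀ g ∈ Submonoid.closure (insert z (Set.range s)), ∀ c : ℂ, ‖c‖ < 1 →
      IsUnit (1 - c • g)) :
    IsUnit (cosetSum α q z s m) := by
  have hzmem : z ∈ Submonoid.closure (insert z (Set.range s)) :=
    Submonoid.subset_closure (Set.mem_insert _ _)
  have hs' : ∀ g ∈ Submonoid.closure (Set.range s), ∀ c : ℂ, ‖c‖ < 1 → IsUnit (1 - c • g) :=
    fun g hg => hs g (Submonoid.closure_mono (Set.subset_insert _ _) hg)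
  cases m with
  | zero => simpa [cosetSum] using hs z hzmem (-α) (by simpa using hα)
  | succ m =>
    have hcyc : ∀ k, cyc s k ∈ Submonoid.closure (insert z (Set.range s)) := fun k => by
      induction k with
      | zero => exact one_mem _
      | succ k ihk =>
        exact mul_mem (Submonoid.subset_closure (Set.mem_insert_of_mem _ ⟨k, rfl⟩)) ihk
    have hc : ‖-(α * q ^ (m + 1))‖ < 1 := by
      rw [norm_neg, norm_mul, norm_pow]
      exact mul_lt_one_of_nonneg_of_lt_one_left (norm_nonneg _) hα
        (pow_le_one₀ (norm_nonneg _) hq.le)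
    have h1 := hs _ (mul_mem (hcyc (m + 1)) hzmem) _ hc
    rw [neg_smul, sub_neg_eq_add] at h1
    have h2 := isUnit_symA hq (h.mono (Nat.le_succ m)) hs'
    rw [← h2.unit.isUnit_units_mul]
    exact symA_mul_cosetSum α q h (fun i hi hi' => hz i hi (by omega)) ▸
      h1.mul (isUnit_symA hq h hs')

/-- Needed because the embedding of group algebras matches the generator sequences only below the
index `n`. -/
theorem cosetSum_congr (α q : ℂ) (z : A) {s s' : ℕ → A} {m : ℕ} (h : ∀ i < m, s i = s' i) :
    cosetSum α q z s m = cosetSum α q z s' m := by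
  have hc : ∀ k ≤ m, cyc s k = cyc s' k ∧ cocyc s k = cocyc s' k := fun k hk => by
    induction k with
    | zero => simp [cyc, cocyc]
    | succ k ih => simp [cyc, cocyc, ih (by omega), h k (by omega)]
  induction m with
  | zero => rfl
  | succ m ih =>
    rw [cosetSum, cosetSum, h m (by omega), (hc (m + 1) le_rfl).1, (hc (m + 1) le_rfl).2,
      ih (fun i hi => h i (by omega)) fun k hk => hc k (by omega)]

theorem map_cosetSum {B : Type*} [Ring B] [Algebra ℂ B] (φ : A →ₐ[ℂ] B) (α q : ℂ) (z : A)
    (s : ℕ → A) (m : ℕ) :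
    φ (cosetSum α q z s m) = cosetSum α q (φ z) (fun i => φ (s i)) m := by
  have hc : ∀ k, φ (cyc s k) = cyc (fun i => φ (s i)) k ∧
      φ (cocyc s k) = cocyc (fun i => φ (s i)) k := fun k => by
    induction k with
    | zero => simp [cyc, cocyc]
    | succ k ih => simp [cyc, cocyc, ih]
  induction m with
  | zero => simp [cosetSum]
  | succ m ih => simp [cosetSum, ih, hc]

end Braid

/-- An element of finite order in a complex algebra has no eigenvalues outside the unit circle. -/
theorem isUnit_one_sub_smul {A : Type*} [Ring A] [Algebra ℂ A] {g : A} (hg : IsOfFinOrder g)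
    {c : ℂ} (hc : ‖c‖ < 1) : IsUnit (1 - c • g) := by
  obtain ⟨k, hk, hgk⟩ := isOfFinOrder_iff_pow_eq_one.1 hg
  have h1 : c ^ k ≠ 1 := fun h => by
    have h2 : ‖c‖ ^ k < 1 := pow_lt_one₀ (norm_nonneg c) hc hk.ne'
    rw [← norm_pow, h, norm_one] at h2
    exact lt_irrefl _ h2
  have h2 : IsUnit (1 - (c • g) ^ k) := by
    rw [smul_pow, hgk]
    have : (1 : A) - c ^ k • (1 : A) = algebraMap ℂ A (1 - c ^ k) := by
      simp [Algebra.algebraMap_eq_smul_one, sub_smul]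
    rw [this]
    exact (IsUnit.mk0 _ (sub_ne_zero.2 h1.symm)).map _
  -- With `x = c • g`, the unit `1 - x ^ k`, a nonzero scalar, is the product of the commuting
  -- elements `1 - x` and a geometric sum, so both are units.
  rw [← mul_neg_geom_sum] at h2
  refine ((Commute.isUnit_mul_iff ?_).1 h2).1
  exact (mul_neg_geom_sum _ _).trans (geom_sum_mul_neg _ _).symm

/-! ### Coset representatives and lengths in `Σ(n)` -/

theorem gen_apply_zero {n : ℕ} {i : Fin n} (hi : i.val = 0) (k : Fin n) (t : ℤˣ) :
    (gen i).1 (k, t) = (k, if k = i then -t else t) := by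
  rcases Int.units_eq_one_or t with rfl | rfl <;>
    by_cases h : k = i <;> simp [gen, hi, Equiv.swap_apply_def, h]

theorem gen_apply_pos {n : ℕ} {i : Fin n} (hi : i.val ≠ 0) (k : Fin n) (t : ℤˣ) :
    (gen i).1 (k, t) = (⟨if k.val = i.val then i.val - 1 else
      if k.val + 1 = i.val then i.val else k.val, by split_ifs <;> omega⟩, t) := by
  simp only [gen, hi, if_false, Equiv.prodCongr_apply, Prod.map, Equiv.refl_apply,
    Equiv.swap_apply_def, Prod.mk.injEq, and_true, Fin.ext_iff]
  split_ifs <;> (try simp) <;> omega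

theorem hyperoctahedral_ext {n : ℕ} {σ τ : hyperoctahedral n}
    (h : ∀ k t, σ.1 (k, t) = τ.1 (k, t)) : σ = τ :=
  Subtype.ext (Equiv.ext fun p => h p.1 p.2)

/-- Extension of a self-map of `{±1, …, ±n}` to `{±1, …, ±(n + 1)}`, fixing `±(n + 1)`. -/
def extendMap {n : ℕ} (f : Fin n × ℤˣ → Fin n × ℤˣ) (p : Fin (n + 1) × ℤˣ) : Fin (n + 1) × ℤˣ :=
  Fin.lastCases (motive := fun _ => Fin (n + 1) × ℤˣ) (Fin.last n, p.2)
    (fun i => ((f (i, p.2)).1.castSucc, (f (i, p.2)).2)) p.1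

@[simp]
theorem extendMap_last {n : ℕ} (f : Fin n × ℤˣ → Fin n × ℤˣ) (t : ℤˣ) :
    extendMap f (Fin.last n, t) = (Fin.last n, t) := by
  simp [extendMap]

@[simp]
theorem extendMap_castSucc {n : ℕ} (f : Fin n × ℤˣ → Fin n × ℤˣ) (i : Fin n) (t : ℤˣ) :
    extendMap f (i.castSucc, t) = ((f (i, t)).1.castSucc, (f (i, t)).2) := by
  simp [extendMap]

theorem extendMap_extendMap {n : ℕ} (f g : Fin n × ℤˣ → Fin n × ℤˣ) (p : Fin (n + 1) × ℤˣ) :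
    extendMap f (extendMap g p) = extendMap (fun x => f (g x)) p := by
  obtain ⟨k, t⟩ := p
  induction k using Fin.lastCases <;> simp

theorem extendMap_id {n : ℕ} (p : Fin (n + 1) × ℤˣ) : extendMap (fun x => x) p = p := by
  obtain ⟨k, t⟩ := p
  induction k using Fin.lastCases <;> simp

/-- The embedding `Σ(n) → Σ(n + 1)` as the stabilizer of `n + 1`. -/
def embed (n : ℕ) : hyperoctahedral n →* hyperoctahedral (n + 1) where
  toFun σ := ⟨{ toFun := extendMap σ.1
                invFun := extendMap (σ.1⁻¹ : Equiv.Perm _)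
                left_inv := fun p => by simp [extendMap_extendMap, extendMap_id]
                right_inv := fun p => by simp [extendMap_extendMap, extendMap_id] }, by
    rintro ⟨k, t⟩
    induction k using Fin.lastCases with
    | last => simp [opp]
    | cast i =>
      have h := σ.2 (i, t)
      simp only [opp] at h
      simp [opp, h]⟩
  map_one' := hyperoctahedral_ext fun k t => extendMap_id (k, t)
  map_mul' σ τ := hyperoctahedral_ext fun k t => (extendMap_extendMap σ.1 τ.1 (k, t)).symm

@[simp]
theorem embed_last {n : ℕ} (σ : hyperoctahedral n) (t : ℤˣ) :
    (embed n σ).1 (Fin.last n, t) = (Fin.last n, t) :=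
  extendMap_last _ _

@[simp]
theorem embed_castSucc {n : ℕ} (σ : hyperoctahedral n) (i : Fin n) (t : ℤˣ) :
    (embed n σ).1 (i.castSucc, t) = ((σ.1 (i, t)).1.castSucc, (σ.1 (i, t)).2) :=
  extendMap_castSucc _ _ _

theorem embed_injective (n : ℕ) : Function.Injective (embed n) := fun σ τ h =>
  hyperoctahedral_ext fun k t => by
    have h1 := congrArg (fun ρ : hyperoctahedral (n + 1) => ρ.1 (k.castSucc, t)) h
    simp only [embed_castSucc, Prod.mk.injEq, Fin.castSucc_inj] at h1
    exact Prod.ext h1.1 h1.2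

theorem embed_gen {n : ℕ} (i : Fin n) : embed n (gen i) = gen i.castSucc :=
  hyperoctahedral_ext fun k t => by
    by_cases hi : i.val = 0
    · have hi' : i.castSucc.val = 0 := hi
      rw [gen_apply_zero hi']
      induction k using Fin.lastCases with
      | last => simp [Fin.ext_iff]; intro; omega
      | cast k => simp [gen_apply_zero hi]
    · have hi' : i.castSucc.val ≠ 0 := hi
      rw [gen_apply_pos hi']
      induction k using Fin.lastCases with
      | last => simp [Fin.ext_iff]; split_ifs <;> omega
      | cast k => simp [gen_apply_pos hi]

theorem exists_embed_eq {n : ℕ} (ρ : hyperoctahedral (n + 1))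
    (h : ρ.1 (Fin.last n, 1) = (Fin.last n, 1)) : ∃ σ, embed n σ = ρ := by
  have h' : ∀ t, ρ.1 (Fin.last n, t) = (Fin.last n, t) := fun t => by
    rcases Int.units_eq_one_or t with rfl | rfl
    · exact h
    · have := ρ.2 (Fin.last n, 1)
      simpa [opp, h] using this
  have hne : ∀ (i : Fin n) (t : ℤˣ), (ρ.1 (i.castSucc, t)).1 ≠ Fin.last n := fun i t hi => by
    have h1 : ρ.1 (i.castSucc, t) = ρ.1 (Fin.last n, (ρ.1 (i.castSucc, t)).2) := by
      rw [h']
      exact Prod.ext hi rfl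
    exact (Fin.castSucc_lt_last i).ne (congrArg Prod.fst (ρ.1.injective h1))
  let f : Fin n × ℤˣ → Fin n × ℤˣ := fun p =>
    ((ρ.1 (p.1.castSucc, p.2)).1.castPred (hne p.1 p.2), (ρ.1 (p.1.castSucc, p.2)).2)
  have hf : Function.Injective f := fun p p' hp => by
    simp only [f, Prod.mk.injEq, Fin.castPred_inj] at hp
    have h1 := ρ.1.injective (Prod.ext hp.1 hp.2)
    simp only [Prod.mk.injEq, Fin.castSucc_inj] at h1
    exact Prod.ext h1.1 h1.2
  refine ⟨⟨Equiv.ofBijective f (Finite.injective_iff_bijective.1 hf), fun p => ?_⟩,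
    hyperoctahedral_ext fun k t => ?_⟩
  · have h1 := ρ.2 (p.1.castSucc, p.2)
    simp only [opp] at h1
    simp [f, opp, h1]
  · induction k using Fin.lastCases with
    | last => rw [embed_last, h']
    | cast i => simp [f]

/-- The minimal coset representative `z` of `Σ(n) ⊆ Σ(n + 1)` with `z p = n + 1`. -/
def rep {n : ℕ} (p : Fin (n + 1) × ℤˣ) : hyperoctahedral (n + 1) :=
  ⟨{  toFun := fun x => (⟨if x.1.val = p.1.val then n else
        if x.1.val < p.1.val then x.1.val else x.1.val - 1, by split_ifs <;> omega⟩,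
        if x.1.val = p.1.val then p.2 * x.2 else x.2)
      invFun := fun x => (⟨if x.1.val = n then p.1.val else
        if x.1.val < p.1.val then x.1.val else x.1.val + 1, by split_ifs <;> omega⟩,
        if x.1.val = n then p.2 * x.2 else x.2)
      left_inv := by
        rintro ⟨k, t⟩
        obtain ⟨⟨b, hb⟩, s⟩ := p
        rcases Int.units_eq_one_or s with rfl | rfl <;>
          ext <;> simp <;> split_ifs <;> first | rfl | omega
      right_inv := by
        rintro ⟨k, t⟩
        obtain ⟨⟨b, hb⟩, s⟩ := p
        rcases Int.units_eq_one_or s with rfl | rfl <;>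
          ext <;> simp <;> split_ifs <;> first | rfl | omega }, by
    rintro ⟨k, t⟩
    simp only [opp, Equiv.coe_fn_mk, Prod.mk.injEq, true_and]
    split_ifs <;> simp⟩

theorem rep_apply {n : ℕ} (p : Fin (n + 1) × ℤˣ) (k : Fin (n + 1)) (t : ℤˣ) :
    (rep p).1 (k, t) = (⟨if k.val = p.1.val then n else
        if k.val < p.1.val then k.val else k.val - 1, by split_ifs <;> omega⟩,
        if k.val = p.1.val then p.2 * t else t) :=
  rfl

theorem rep_self {n : ℕ} (p : Fin (n + 1) × ℤˣ) : (rep p).1 p = (Fin.last n, 1) := by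
  obtain ⟨b, s⟩ := p
  rw [rep_apply]
  simp [Fin.ext_iff]

/-- The product sends `p` to `n + 1`, so `p` is recovered as the preimage of `n + 1`. Conversely,
dividing `ρ` by the representative of that preimage leaves an element fixing `n + 1`. -/
theorem embed_mul_rep_bijective (n : ℕ) : Function.Bijective
    fun x : hyperoctahedral n × (Fin (n + 1) × ℤˣ) => embed n x.1 * rep x.2 := by
  have h : ∀ (σ : hyperoctahedral n) p, (embed n σ * rep p).1 p = (Fin.last n, 1) := fun σ p => by
    change (embed n σ).1 ((rep p).1 p) = _
    rw [rep_self, embed_last]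
  constructor
  · rintro ⟨σ, p⟩ ⟨τ, p'⟩ hx
    simp only at hx
    have h1 : p = p' := (embed n σ * rep p).1.injective ((h σ p).trans (hx ▸ (h τ p').symm))
    subst h1
    rw [embed_injective n (mul_right_cancel hx)]
  · intro ρ
    obtain ⟨σ, hσ⟩ := exists_embed_eq (ρ * (rep (ρ.1⁻¹ (Fin.last n, 1)))⁻¹) (by
      change ρ.1 ((rep (ρ.1⁻¹ (Fin.last n, 1))).1⁻¹ (Fin.last n, 1)) = _
      rw [Equiv.Perm.inv_eq_iff_eq.2 (rep_self _).symm]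
      simp)
    exact ⟨(σ, ρ.1⁻¹ (Fin.last n, 1)), by simp [hσ]⟩

/-- The factorization of the elements of `Σ(n + 1)` over the cosets of `Σ(n)`. -/
def cosetEquiv (n : ℕ) :
    hyperoctahedral n × (Fin (n + 1) × ℤˣ) ≃ hyperoctahedral (n + 1) :=
  Equiv.ofBijective _ (embed_mul_rep_bijective n)

theorem cosetEquiv_apply {n : ℕ} (σ : hyperoctahedral n) (p : Fin (n + 1) × ℤˣ) :
    cosetEquiv n (σ, p) = embed n σ * rep p :=
  rfl

/-- The pair `(l₁, l₂)` of a generator. -/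
def genLength {n : ℕ} (i : Fin n) : ℕ × ℕ := if i.val = 0 then (1, 0) else (0, 1)

/-- The pair `(l₁, l₂)` of a coset representative. -/
def repLength {n : ℕ} (p : Fin (n + 1) × ℤˣ) : ℕ × ℕ :=
  if p.2 = 1 then (0, n - p.1.val) else (1, n + p.1.val)

/-- The pair `(l₁, l₂)`, computed recursively from the factorization over cosets. -/
def biLength : (n : ℕ) → hyperoctahedral n → ℕ × ℕ
  | 0, _ => 0
  | n + 1, σ => biLength n ((cosetEquiv n).symm σ).1 + repLength ((cosetEquiv n).symm σ).2

/-! ### Word lengths compared with the recursive pair -/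

theorem biLength_embed_mul_rep {n : ℕ} (σ : hyperoctahedral n) (p : Fin (n + 1) × ℤˣ) :
    biLength (n + 1) (embed n σ * rep p) = biLength n σ + repLength p := by
  rw [biLength, ← cosetEquiv_apply, Equiv.symm_apply_apply]

theorem rep_mul_gen_of_ne {n : ℕ} {p : Fin (n + 1) × ℤˣ} {i : Fin (n + 1)}
    (h : ((gen i).1 p) ≠ p) : rep p * gen i = rep ((gen i).1 p) := by
  obtain ⟨b, s⟩ := p
  refine hyperoctahedral_ext fun k t => ?_
  change (rep (b, s)).1 ((gen i).1 (k, t)) = _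
  by_cases hi : i.val = 0
  · rw [gen_apply_zero hi] at h ⊢
    rw [gen_apply_zero hi, rep_apply, rep_apply]
    have hb : b = i := by
      by_contra hb
      simp [hb] at h
    subst hb
    simp only [Fin.ext_iff]
    by_cases hk : k.val = b.val <;> simp [hk]
  · rw [gen_apply_pos hi] at h ⊢
    rw [gen_apply_pos hi, rep_apply, rep_apply]
    have hb : b.val = i.val ∨ b.val + 1 = i.val := by
      by_contra hb
      push Not at hb
      simp [hb] at h
    simp only [Prod.mk.injEq, Fin.mk.injEq]
    constructor
    · split_ifs <;> omega
    · split_ifs <;> first | rfl | omega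

theorem repLength_gen_le {n : ℕ} (p : Fin (n + 1) × ℤˣ) (i : Fin (n + 1)) :
    repLength ((gen i).1 p) ≤ repLength p + genLength i := by
  obtain ⟨b, s⟩ := p
  by_cases hi : i.val = 0
  · rw [gen_apply_zero hi]
    rcases Int.units_eq_one_or s with rfl | rfl <;> by_cases hb : b = i <;>
      simp [repLength, genLength, hi, hb]
  · rw [gen_apply_pos hi]
    rcases Int.units_eq_one_or s with rfl | rfl <;>
      simp [repLength, genLength, hi] <;> split_ifs <;> omega

/-- Together with `rep_mul_gen_of_ne` this is Deodhar's dichotomy: a generator either moves a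
minimal representative to another one, or passes through it to a generator of `Σ(n)` of the same
type. -/
theorem rep_mul_gen_of_eq {n : ℕ} {p : Fin (n + 1) × ℤˣ} {i : Fin (n + 1)}
    (h : ((gen i).1 p) = p) :
    ∃ j : Fin n, genLength j = genLength i ∧ rep p * gen i = embed n (gen j) * rep p := by
  obtain ⟨b, s⟩ := p
  by_cases hi : i.val = 0
  · rw [gen_apply_zero hi] at h
    have hb : b.val ≠ 0 := fun hb => by
      have : b = i := Fin.ext (hb.trans hi.symm)
      simp [this] at h
    refine ⟨⟨0, by omega⟩, by simp [genLength, hi], hyperoctahedral_ext fun k t => ?_⟩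
    change (rep (b, s)).1 ((gen i).1 (k, t)) = (embed n _).1 ((rep (b, s)).1 (k, t))
    rw [embed_gen, gen_apply_zero hi, rep_apply, rep_apply, gen_apply_zero rfl]
    simp only [Prod.mk.injEq, Fin.ext_iff, true_and, Fin.castSucc_mk]
    split_ifs <;> first | rfl | omega
  · rw [gen_apply_pos hi] at h
    have hb : b.val ≠ i.val ∧ b.val + 1 ≠ i.val := by
      simp only [Prod.mk.injEq, Fin.ext_iff, and_true] at h
      split_ifs at h <;> omega
    by_cases hlt : i.val < b.val
    · refine ⟨⟨i.val, by omega⟩, by simp [genLength], hyperoctahedral_ext fun k t => ?_⟩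
      change (rep (b, s)).1 ((gen i).1 (k, t)) = (embed n _).1 ((rep (b, s)).1 (k, t))
      rw [embed_gen, gen_apply_pos hi, rep_apply, rep_apply,
        gen_apply_pos (by simpa only [Fin.castSucc_mk] using hi)]
      simp only [Prod.mk.injEq, Fin.mk.injEq, Fin.castSucc_mk]
      constructor
      · split_ifs <;> omega
      · split_ifs <;> first | rfl | omega
    -- Here `i > b + 1`; the representative closes the gap at `b`, so positions above `b` drop by
    -- one. The index `i - 1` is still positive, so the type of the generator is kept.
    · refine ⟨⟨i.val - 1, by omega⟩, by simp [genLength, hi]; omega,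
        hyperoctahedral_ext fun k t => ?_⟩
      change (rep (b, s)).1 ((gen i).1 (k, t)) = (embed n _).1 ((rep (b, s)).1 (k, t))
      rw [embed_gen, gen_apply_pos hi, rep_apply, rep_apply,
        gen_apply_pos (by simp only [Fin.castSucc_mk]; omega)]
      simp only [Prod.mk.injEq, Fin.mk.injEq, Fin.castSucc_mk]
      constructor
      · split_ifs <;> omega
      · split_ifs <;> first | rfl | omega

theorem biLength_mul_gen_le {n : ℕ} (σ : hyperoctahedral n) (i : Fin n) :
    biLength n (σ * gen i) ≤ biLength n σ + genLength i := by
  induction n with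
  | zero => exact i.elim0
  | succ n ih =>
    obtain ⟨⟨τ, p⟩, rfl⟩ := (cosetEquiv n).surjective σ
    rw [cosetEquiv_apply, mul_assoc, biLength_embed_mul_rep]
    by_cases h : (gen i).1 p = p
    · obtain ⟨j, hj, hp⟩ := rep_mul_gen_of_eq h
      rw [hp, ← mul_assoc, ← map_mul, biLength_embed_mul_rep, ← hj, add_right_comm]
      gcongr
      exact ih τ j
    · rw [rep_mul_gen_of_ne h, biLength_embed_mul_rep, add_assoc]
      gcongr
      exact repLength_gen_le p i

theorem rep_last_one (n : ℕ) : rep (Fin.last n, 1) = 1 :=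
  hyperoctahedral_ext fun k t => by
    rw [rep_apply]
    ext
    · simp
      split_ifs <;> omega
    · simp

theorem biLength_one (n : ℕ) : biLength n 1 = 0 := by
  induction n with
  | zero => rfl
  | succ n ih =>
    have h := biLength_embed_mul_rep (1 : hyperoctahedral n) (Fin.last n, 1)
    rw [rep_last_one, map_one, mul_one, ih] at h
    rw [h]
    simp [repLength]

theorem biLength_prod_le {n : ℕ} (w : List (Fin n)) :
    biLength n (w.map gen).prod ≤ (w.map genLength).sum := by
  induction w using List.reverseRecOn with
  | nil => simp [biLength_one]
  | append_singleton w i ih =>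
    simp only [List.map_append, List.prod_append, List.sum_append, List.map_cons, List.map_nil,
      List.prod_singleton, List.sum_singleton]
    exact (biLength_mul_gen_le _ _).trans (by gcongr)

theorem exists_word_rep {n : ℕ} (p : Fin (n + 1) × ℤˣ) :
    ∃ w : List (Fin (n + 1)), (w.map gen).prod = rep p ∧
      (w.map genLength).sum = repLength p := by
  have step : ∀ (p : Fin (n + 1) × ℤˣ) (i : Fin (n + 1)), (gen i).1 p ≠ p →
      repLength ((gen i).1 p) = repLength p + genLength i →
      (∃ w : List (Fin (n + 1)), (w.map gen).prod = rep p ∧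
        (w.map genLength).sum = repLength p) →
      ∃ w : List (Fin (n + 1)), (w.map gen).prod = rep ((gen i).1 p) ∧
        (w.map genLength).sum = repLength ((gen i).1 p) := by
    rintro p i h1 h2 ⟨w, hw, hw'⟩
    exact ⟨w ++ [i], by simp [hw, rep_mul_gen_of_ne h1], by simp [hw', h2]⟩
  -- Words are built along the orbit of the last point: down from `n` to `0` with positive sign,
  -- through `π₀` to the negative sign, then up again.
  have pos : ∀ (m b : ℕ) (hb : b + m = n), ∃ w : List (Fin (n + 1)),
      (w.map gen).prod = rep (⟨b, by omega⟩, 1) ∧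
        (w.map genLength).sum = repLength ((⟨b, by omega⟩ : Fin (n + 1)), 1) := by
    intro m
    induction m with
    | zero =>
      intro b hb
      have : (⟨b, by omega⟩ : Fin (n + 1)) = Fin.last n := Fin.ext (by simpa using hb)
      exact ⟨[], by simp [this, rep_last_one], by rw [this]; simp [repLength]; rfl⟩
    | succ m ih =>
      intro b hb
      have h := step (⟨b + 1, by omega⟩, 1) ⟨b + 1, by omega⟩
      rw [gen_apply_pos (by simp)] at h
      simpa using h (by simp) (by simp [repLength, genLength]; omega) (ih (b + 1) (by omega))
  have neg : ∀ (b : ℕ) (hb : b < n + 1), ∃ w : List (Fin (n + 1)),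
      (w.map gen).prod = rep (⟨b, hb⟩, -1) ∧
        (w.map genLength).sum = repLength ((⟨b, hb⟩ : Fin (n + 1)), -1) := by
    intro b
    induction b with
    | zero =>
      intro hb
      have h := step (⟨0, hb⟩, 1) ⟨0, hb⟩
      rw [gen_apply_zero rfl] at h
      simpa using h (by simp) (by simp [repLength, genLength]) (pos n 0 (by omega))
    | succ b ih =>
      intro hb
      have h := step (⟨b, by omega⟩, -1) ⟨b + 1, hb⟩
      rw [gen_apply_pos (by simp)] at h
      simpa using h (by simp) (by simp [repLength, genLength]; omega) (ih (by omega))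
  obtain ⟨b, s⟩ := p
  rcases Int.units_eq_one_or s with rfl | rfl
  · exact pos (n - b.val) b.val (by omega)
  · exact neg b.val b.isLt

theorem exists_word {n : ℕ} (σ : hyperoctahedral n) :
    ∃ w : List (Fin n), (w.map gen).prod = σ ∧ (w.map genLength).sum = biLength n σ := by
  induction n with
  | zero => exact ⟨[], hyperoctahedral_ext fun k => k.elim0, rfl⟩
  | succ n ih =>
    obtain ⟨⟨τ, p⟩, rfl⟩ := (cosetEquiv n).surjective σ
    obtain ⟨w, hw, hw'⟩ := ih τ
    obtain ⟨v, hv, hv'⟩ := exists_word_rep p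
    refine ⟨w.map Fin.castSucc ++ v, ?_, ?_⟩
    · have h : ∀ u : List (Fin n), (u.map fun i => gen i.castSucc).prod =
          embed n (u.map gen).prod := fun u => by
        rw [map_list_prod, List.map_map]
        congr 2
        funext i
        exact (embed_gen i).symm
      rw [List.map_append, List.prod_append, hv, List.map_map, cosetEquiv_apply, ← hw, ← h]
      rfl
    · have h : (genLength ∘ Fin.castSucc : Fin n → ℕ × ℕ) = genLength := rfl
      rw [List.map_append, List.sum_append, hv', List.map_map, h, hw', cosetEquiv_apply,
        biLength_embed_mul_rep]

theorem sum_genLength {n : ℕ} (w : List (Fin n)) : (w.map genLength).sum =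
    (w.countP (fun i => i.val = 0), w.countP (fun i => i.val ≠ 0)) := by
  induction w with
  | nil => rfl
  | cons i w ih =>
    rw [List.map_cons, List.sum_cons, ih]
    by_cases hi : i.val = 0 <;> simp [genLength, hi, add_comm]

theorem length_eq_sum_genLength {n : ℕ} (w : List (Fin n)) :
    w.length = (w.map genLength).sum.1 + (w.map genLength).sum.2 := by
  rw [sum_genLength, List.length_eq_countP_add_countP (fun i : Fin n => decide (i.val = 0))]
  simp

/-- Every word for `σ` dominates `biLength` in both components, and some word attains it. Minimal
total length then forces equality in each component, which is why `l₁` and `l₂` do not depend on the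
word. -/
theorem IsIrreducibleForm.sum_genLength_eq {n : ℕ} {w : List (Fin n)} {σ : hyperoctahedral n}
    (h : IsIrreducibleForm w σ) : (w.map genLength).sum = biLength n σ := by
  obtain ⟨v, hv, hv'⟩ := exists_word σ
  have h1 := h.2 v hv
  have h2 := h.1 ▸ biLength_prod_le w
  rw [length_eq_sum_genLength, length_eq_sum_genLength, hv'] at h1
  have h3 := Prod.le_def.1 h2
  exact Prod.ext (by omega) (by omega)

theorem exists_isIrreducibleForm {n : ℕ} (σ : hyperoctahedral n) :
    ∃ w, IsIrreducibleForm w σ := by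
  obtain ⟨w, hw, hw'⟩ := exists_word σ
  refine ⟨w, hw, fun v hv => ?_⟩
  have h2 := Prod.le_def.1 (hv ▸ biLength_prod_le v)
  rw [length_eq_sum_genLength, length_eq_sum_genLength, hw']
  omega

theorem l₁_eq {n : ℕ} (σ : hyperoctahedral n) : l₁ σ = (biLength n σ).1 := by
  have h : {m | ∃ w : List (Fin n), IsIrreducibleForm w σ ∧
      m = w.countP (fun i => i.val = 0)} = {(biLength n σ).1} := by
    ext m
    constructor
    · rintro ⟨w, hw, rfl⟩
      rw [Set.mem_singleton_iff, ← hw.sum_genLength_eq, sum_genLength]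
    · rintro rfl
      obtain ⟨w, hw⟩ := exists_isIrreducibleForm σ
      exact ⟨w, hw, by rw [← hw.sum_genLength_eq, sum_genLength]⟩
  rw [l₁, h, csInf_singleton]

theorem l₂_eq {n : ℕ} (σ : hyperoctahedral n) : l₂ σ = (biLength n σ).2 := by
  have h : {m | ∃ w : List (Fin n), IsIrreducibleForm w σ ∧
      m = w.countP (fun i => i.val ≠ 0)} = {(biLength n σ).2} := by
    ext m
    constructor
    · rintro ⟨w, hw, rfl⟩
      rw [Set.mem_singleton_iff, ← hw.sum_genLength_eq, sum_genLength]
    · rintro rfl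
      obtain ⟨w, hw⟩ := exists_isIrreducibleForm σ
      exact ⟨w, hw, by rw [← hw.sum_genLength_eq, sum_genLength]⟩
  rw [l₂, h, csInf_singleton]

/-! ### The symmetrizer in the group algebra of `Σ(n)` -/

/-- The symmetrizer `∑ α^{l₁(σ)} q^{l₂(σ)} σ` in the group algebra. -/
def symElement (α q : ℂ) (n : ℕ) : MonoidAlgebra ℂ (hyperoctahedral n) :=
  ∑ σ : hyperoctahedral n, (α ^ l₁ σ * q ^ l₂ σ) • MonoidAlgebra.of ℂ _ σ

/-- The sum over the minimal coset representatives of `Σ(n) ⊆ Σ(n + 1)` in the group algebra. -/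
def cosetElement (α q : ℂ) (n : ℕ) : MonoidAlgebra ℂ (hyperoctahedral (n + 1)) :=
  ∑ p : Fin (n + 1) × ℤˣ, (α ^ (repLength p).1 * q ^ (repLength p).2) • MonoidAlgebra.of ℂ _ (rep p)

/-- The homomorphism of group algebras induced by the embedding of `Σ(n)` in `Σ(n + 1)`. -/
def embedAlg (n : ℕ) :
    MonoidAlgebra ℂ (hyperoctahedral n) →ₐ[ℂ] MonoidAlgebra ℂ (hyperoctahedral (n + 1)) :=
  MonoidAlgebra.mapDomainAlgHom ℂ ℂ (embed n)

@[simp]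
theorem embedAlg_of {n : ℕ} (σ : hyperoctahedral n) :
    embedAlg n (MonoidAlgebra.of ℂ _ σ) = MonoidAlgebra.of ℂ _ (embed n σ) := by
  simp [embedAlg]

/-- Both lengths are additive along `σ = embed τ * rep p`, so the weighted sum over the group splits
as a product. -/
theorem symElement_succ (α q : ℂ) (n : ℕ) :
    symElement α q (n + 1) = embedAlg n (symElement α q n) * cosetElement α q n := by
  rw [symElement, symElement, cosetElement, map_sum, Finset.sum_mul_sum,
    ← (cosetEquiv n).sum_comp, Fintype.sum_prod_type]
  refine Finset.sum_congr rfl fun σ _ => Finset.sum_congr rfl fun p _ => ?_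
  rw [cosetEquiv_apply, l₁_eq, l₂_eq, l₁_eq, l₂_eq, biLength_embed_mul_rep, map_smul, embedAlg_of,
    smul_mul_smul_comm, ← map_mul]
  congr 1
  rw [Prod.fst_add, Prod.snd_add, pow_add, pow_add]
  ring

/-! ### Recursion for the coset sum -/

theorem rep_castSucc {n : ℕ} (b : Fin (n + 1)) (s : ℤˣ) :
    rep (b.castSucc, s) = gen (Fin.last (n + 1)) * embed (n + 1) (rep (b, s)) :=
  hyperoctahedral_ext fun k t => by
    change _ = (gen (Fin.last (n + 1))).1 ((embed (n + 1) (rep (b, s))).1 (k, t))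
    rw [rep_apply]
    induction k using Fin.lastCases with
    | last =>
      rw [embed_last, gen_apply_pos (by simp)]
      ext
      · simp
        split_ifs <;> omega
      · dsimp only
        rw [if_neg (by simp; omega)]
    | cast k =>
      rw [embed_castSucc, rep_apply, gen_apply_pos (by simp)]
      ext
      · simp
        split_ifs <;> omega
      · simp

/-- This representative only changes the sign of the last point, so it is the conjugate of the
previous sign change by the last transposition. -/
theorem rep_last_neg_one (n : ℕ) : rep (Fin.last (n + 1), -1) =
    gen (Fin.last (n + 1)) * embed (n + 1) (rep (Fin.last n, -1)) * gen (Fin.last (n + 1)) := by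
  have h1 : ∀ t, (gen (Fin.last (n + 1))).1 (Fin.last (n + 1), t) =
      ((Fin.last n).castSucc, t) := fun t => by
    rw [gen_apply_pos (by simp)]
    ext <;> simp
  have h2 : ∀ t, (gen (Fin.last (n + 1))).1 ((Fin.last n).castSucc, t) =
      (Fin.last (n + 1), t) := fun t => by
    rw [gen_apply_pos (by simp)]
    ext <;> simp
  refine hyperoctahedral_ext fun k t => ?_
  change _ = (gen (Fin.last (n + 1))).1 ((embed (n + 1) (rep (Fin.last n, -1))).1
    ((gen (Fin.last (n + 1))).1 (k, t)))
  induction k using Fin.lastCases with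
  | last =>
    have h3 : (rep (Fin.last n, -1)).1 (Fin.last n, t) = (Fin.last n, -t) := by
      rw [rep_apply]
      ext <;> simp
    rw [h1, embed_castSucc, h3, h2, rep_apply]
    ext <;> simp
  | cast k =>
    by_cases hk : k = Fin.last n
    · subst hk
      rw [h2, embed_last, h1, rep_apply]
      ext <;> simp
    · have hk' : k.val < n := Fin.val_lt_last hk
      have h3 : (gen (Fin.last (n + 1))).1 (k.castSucc, t) = (k.castSucc, t) := by
        rw [gen_apply_pos (by simp)]
        ext
        · simp
          split_ifs <;> omega
        · rfl
      have h4 : (rep (Fin.last n, -1)).1 (k, t) = (k, t) := by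
        rw [rep_apply]
        ext
        · simp
          split_ifs <;> omega
        · dsimp only
          rw [if_neg (by simp; omega)]
      rw [h3, embed_castSucc, h4, h3, rep_apply]
      ext
      · simp
        split_ifs <;> omega
      · dsimp only
        rw [if_neg (by simp; omega)]

theorem rep_zero_neg_one : rep ((0 : Fin 1), -1) = gen 0 :=
  hyperoctahedral_ext fun k t => by
    obtain rfl : k = 0 := Fin.ext (by omega)
    rw [rep_apply, gen_apply_zero rfl]
    ext <;> simp

theorem cosetElement_zero (α q : ℂ) :
    cosetElement α q 0 = 1 + α • MonoidAlgebra.of ℂ _ (gen (0 : Fin 1)) := by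
  have h1 : rep ((0 : Fin 1), 1) = 1 := rep_last_one 0
  rw [cosetElement, Fintype.sum_prod_type, Fin.sum_univ_one, UnitsInt.univ,
    Finset.sum_pair (by decide), rep_zero_neg_one, h1, map_one]
  simp [repLength]

/-- Representatives of points `±k` below the last one carry one extra `π` on the left. The two left
over are the identity and the sign change of the last point, whose pair of lengths is `(1, 2 * (n +
1))`. -/
theorem cosetElement_succ (α q : ℂ) (n : ℕ) :
    cosetElement α q (n + 1) =
      1 + q • (MonoidAlgebra.of ℂ _ (gen (Fin.last (n + 1))) *
        embedAlg (n + 1) (cosetElement α q n)) +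
      (α * q ^ (2 * (n + 1))) • MonoidAlgebra.of ℂ _ (rep (Fin.last (n + 1), -1)) := by
  have h : ∀ p : Fin (n + 1) × ℤˣ, repLength (p.1.castSucc, p.2) = repLength p + (0, 1) := by
    rintro ⟨b, s⟩
    rcases Int.units_eq_one_or s with rfl | rfl <;> simp [repLength] <;> omega
  have h1 : ∀ p : Fin (n + 1) × ℤˣ,
      (α ^ (repLength (p.1.castSucc, p.2)).1 * q ^ (repLength (p.1.castSucc, p.2)).2) •
        MonoidAlgebra.of ℂ _ (rep (p.1.castSucc, p.2)) =
      q • (MonoidAlgebra.of ℂ _ (gen (Fin.last (n + 1))) *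
        embedAlg (n + 1) ((α ^ (repLength p).1 * q ^ (repLength p).2) •
          MonoidAlgebra.of ℂ _ (rep p))) := fun p => by
    rw [h, rep_castSucc, map_mul, map_smul, embedAlg_of, mul_smul_comm, smul_smul]
    congr 1
    rw [Prod.fst_add, Prod.snd_add, add_zero, pow_succ]
    ring
  have h2 : ∑ s : ℤˣ, (α ^ (repLength (Fin.last (n + 1), s)).1 *
        q ^ (repLength (Fin.last (n + 1), s)).2) •
        MonoidAlgebra.of ℂ _ (rep (Fin.last (n + 1), s)) =
      1 + (α * q ^ (2 * (n + 1))) • MonoidAlgebra.of ℂ _ (rep (Fin.last (n + 1), -1)) := by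
    have h3 : repLength (Fin.last (n + 1), 1) = (0, 0) := by simp [repLength]
    have h4 : repLength (Fin.last (n + 1), -1) = (1, 2 * (n + 1)) := by
      simp [repLength, two_mul]
    rw [UnitsInt.univ, Finset.sum_pair (by decide), rep_last_one, map_one, h3, h4, pow_zero,
      pow_zero, pow_one, mul_one, one_smul]
  rw [cosetElement, Fintype.sum_prod_type, Fin.sum_univ_castSucc, h2, cosetElement, map_sum,
    Finset.mul_sum, Finset.smul_sum, Fintype.sum_prod_type, ← add_assoc,
    add_comm (1 : MonoidAlgebra _ _)]
  congr 2
  exact Finset.sum_congr rfl fun b _ => Finset.sum_congr rfl fun s _ => h1 (b, s)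

/-- The generators `π₁, π₂, …` of `Σ(n + 1)` in the group algebra. -/
def genSeq (n i : ℕ) : MonoidAlgebra ℂ (hyperoctahedral (n + 1)) :=
  MonoidAlgebra.of ℂ _ (if h : i + 1 < n + 1 then gen ⟨i + 1, h⟩ else 1)

theorem genSeq_of_lt {n i : ℕ} (h : i < n) :
    genSeq n i = MonoidAlgebra.of ℂ _ (gen ⟨i + 1, by omega⟩) := by
  rw [genSeq, dif_pos (by omega)]

theorem embedAlg_genSeq {n i : ℕ} (h : i < n) :
    embedAlg (n + 1) (genSeq n i) = genSeq (n + 1) i := by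
  rw [genSeq_of_lt h, genSeq_of_lt (by omega), embedAlg_of, embed_gen]
  rfl

theorem gen_apply_swap {n i : ℕ} (hi : i < n) (k : Fin (n + 1)) (t : ℤˣ) :
    (gen (⟨i + 1, by omega⟩ : Fin (n + 1))).1 (k, t) =
      (Equiv.swap ⟨i, by omega⟩ ⟨i + 1, by omega⟩ k, t) :=
  rfl

theorem isBraid_genSeq (n : ℕ) : IsBraid (genSeq n) n where
  braid i hi := by
    rw [genSeq_of_lt hi, genSeq_of_lt (show i < n by omega), ← map_mul, ← map_mul, ← map_mul,
      ← map_mul]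
    refine congrArg _ (hyperoctahedral_ext fun k t => ?_)
    simp only [Subgroup.coe_mul, Equiv.Perm.mul_apply, gen_apply_swap hi,
      gen_apply_swap (show i < n by omega)]
    -- Both sides of the braid relation are the transposition of the positions `i` and `i + 2`.
    have h1 := Equiv.swap_mul_swap_mul_swap (x := (⟨i, by omega⟩ : Fin (n + 1)))
      (y := ⟨i + 1, by omega⟩) (z := ⟨i + 1 + 1, by omega⟩) (by simp) (by simp; omega)
    have h2 := Equiv.swap_mul_swap_mul_swap (x := (⟨i + 1 + 1, by omega⟩ : Fin (n + 1)))
      (y := ⟨i + 1, by omega⟩) (z := ⟨i, by omega⟩) (by simp) (by simp; omega)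
    rw [Equiv.swap_comm (⟨i + 1 + 1, _⟩ : Fin (n + 1)) ⟨i, _⟩] at h1
    rw [Equiv.swap_comm (⟨i + 1, _⟩ : Fin (n + 1)) ⟨i, _⟩,
      Equiv.swap_comm (⟨i + 1 + 1, _⟩ : Fin (n + 1)) ⟨i + 1, _⟩, ← h1] at h2
    exact congrArg (fun e : Equiv.Perm (Fin (n + 1)) => (e k, t)) h2
  comm i j hi hj := by
    rw [genSeq_of_lt hj, genSeq_of_lt (show i < n by omega), ← map_mul, ← map_mul]
    refine congrArg _ (hyperoctahedral_ext fun k t => ?_)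
    simp only [Subgroup.coe_mul, Equiv.Perm.mul_apply, gen_apply_swap hj,
      gen_apply_swap (show i < n by omega)]
    have h := (Equiv.Perm.disjoint_swap_swap (x := (⟨i, by omega⟩ : Fin (n + 1)))
      (y := ⟨i + 1, by omega⟩) (z := ⟨j, by omega⟩) (t := ⟨j + 1, by omega⟩)
      (by simp; omega)).commute.eq
    exact congrArg (fun e : Equiv.Perm (Fin (n + 1)) => (e k, t)) h

theorem genSeq_comm_gen_zero {n i : ℕ} (hi : 1 ≤ i) (hin : i < n) :
    genSeq n i * MonoidAlgebra.of ℂ _ (gen 0) = MonoidAlgebra.of ℂ _ (gen 0) * genSeq n i := by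
  rw [genSeq_of_lt hin, ← map_mul, ← map_mul]
  refine congrArg _ (hyperoctahedral_ext fun k t => ?_)
  simp only [Subgroup.coe_mul, Equiv.Perm.mul_apply]
  simp only [gen_apply_pos (show (⟨i + 1, by omega⟩ : Fin (n + 1)).val ≠ 0 by simp),
    gen_apply_zero (show (0 : Fin (n + 1)).val = 0 by simp), Fin.ext_iff]
  ext
  · rfl
  · have h : (if k.val = i + 1 then i + 1 - 1 else if k.val + 1 = i + 1 then i + 1 else k.val) = 0 ↔
        k.val = 0 := by
      split_ifs <;> constructor <;> intro <;> first | omega | contradiction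
    exact congrArg Units.val (if_congr h.symm rfl rfl)

theorem of_rep_last_neg_one (n : ℕ) :
    MonoidAlgebra.of ℂ _ (rep (Fin.last n, -1)) =
      cyc (genSeq n) n * MonoidAlgebra.of ℂ _ (gen 0) * cocyc (genSeq n) n := by
  have hc : ∀ n k : ℕ, k ≤ n → embedAlg (n + 1) (cyc (genSeq n) k) = cyc (genSeq (n + 1)) k ∧
      embedAlg (n + 1) (cocyc (genSeq n) k) = cocyc (genSeq (n + 1)) k := fun n k hk => by
    induction k with
    | zero => simp [cyc, cocyc]
    | succ k ih =>
      simp [cyc, cocyc, ih (by omega), embedAlg_genSeq (show k < n by omega)]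
  induction n with
  | zero =>
    simp only [cyc, cocyc, one_mul, mul_one]
    exact congrArg _ rep_zero_neg_one
  | succ n ih =>
    have hl : genSeq (n + 1) n = MonoidAlgebra.of ℂ _ (gen (Fin.last (n + 1))) :=
      genSeq_of_lt (by omega)
    rw [rep_last_neg_one, map_mul, map_mul, ← embedAlg_of, ih, map_mul, map_mul, (hc n n le_rfl).1,
      (hc n n le_rfl).2, embedAlg_of, embed_gen, cyc, cocyc, hl]
    simp only [mul_assoc]
    rfl

theorem cosetElement_eq_cosetSum (α q : ℂ) (n : ℕ) :
    cosetElement α q n = cosetSum α q (MonoidAlgebra.of ℂ _ (gen 0)) (genSeq n) n := by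
  induction n with
  | zero => exact cosetElement_zero α q
  | succ n ih =>
    have hl : genSeq (n + 1) n = MonoidAlgebra.of ℂ _ (gen (Fin.last (n + 1))) :=
      genSeq_of_lt (by omega)
    rw [cosetElement_succ, of_rep_last_neg_one, ih, map_cosetSum,
      cosetSum_congr α q _ fun i hi => embedAlg_genSeq hi, embedAlg_of, embed_gen, cosetSum, hl]
    rfl

theorem isUnit_cosetElement {α q : ℂ} (hα : ‖α‖ < 1) (hq : ‖q‖ < 1) (n : ℕ) :
    IsUnit (cosetElement α q n) := by
  rw [cosetElement_eq_cosetSum]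
  refine isUnit_cosetSum hα hq (isBraid_genSeq n) (fun i hi hi' => genSeq_comm_gen_zero hi hi')
    fun g hg c hc => isUnit_one_sub_smul ?_ hc
  have h : Submonoid.closure (insert (MonoidAlgebra.of ℂ _ (gen 0)) (Set.range (genSeq n))) ≤
      MonoidHom.mrange (MonoidAlgebra.of ℂ (hyperoctahedral (n + 1))) := by
    rw [Submonoid.closure_le, Set.insert_subset_iff]
    exact ⟨⟨_, rfl⟩, by rintro _ ⟨i, rfl⟩; exact ⟨_, rfl⟩⟩
  obtain ⟨σ, rfl⟩ := h hg
  exact MonoidHom.isOfFinOrder _ (isOfFinOrder_of_finite σ)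

theorem isUnit_symElement {α q : ℂ} (hα : ‖α‖ < 1) (hq : ‖q‖ < 1) (n : ℕ) :
    IsUnit (symElement α q n) := by
  induction n with
  | zero =>
    have h : ∀ σ : hyperoctahedral 0, σ = 1 := fun σ => hyperoctahedral_ext fun k => k.elim0
    have hu : (Finset.univ : Finset (hyperoctahedral 0)) = {1} :=
      Finset.eq_singleton_iff_unique_mem.2 ⟨Finset.mem_univ _, fun σ _ => h σ⟩
    rw [symElement, hu, Finset.sum_singleton, l₁_eq, l₂_eq]
    simp only [biLength, Prod.fst_zero, Prod.snd_zero, pow_zero, mul_one, one_smul, map_one]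
    exact isUnit_one
  | succ n ih =>
    rw [symElement_succ]
    exact (ih.map _).mul (isUnit_cosetElement hα hq n)

/-! ### Contraction of the last tensor factor -/

section Contraction

variable {H : Type*} [NormedAddCommGroup H] [InnerProductSpace ℂ H]

/-- The map `x₁ ⊗ ⋯ ⊗ xₙ₊₁ ↦ ⟨x, xₙ₊₁⟩ x₁ ⊗ ⋯ ⊗ xₙ`. -/
def contract (x : H) (n : ℕ) : (⨂[ℂ]^(n + 1) H) →ₗ[ℂ] (⨂[ℂ]^n H) :=
  PiTensorProduct.lift (MultilinearMap.uncurryRight (M := fun _ : Fin (n + 1) => H)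
    ((LinearMap.smulRightₗ (innerSL ℂ x).toLinearMap).compMultilinearMap
      (PiTensorProduct.tprod ℂ (s := fun _ : Fin n => H))))

@[simp]
theorem contract_tprod (x : H) (n : ℕ) (v : Fin (n + 1) → H) :
    contract x n (PiTensorProduct.tprod ℂ v) =
      inner ℂ x (v (Fin.last n)) • PiTensorProduct.tprod ℂ (Fin.init (α := fun _ => H) v) := by
  simp [contract]

theorem tensor_ext {n : ℕ} {E : Type*} [AddCommMonoid E] [Module ℂ E]
    {f g : (⨂[ℂ]^n H) →ₗ[ℂ] E}
    (h : ∀ v : Fin n → H, f (PiTensorProduct.tprod ℂ v) = g (PiTensorProduct.tprod ℂ v)) : f = g :=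
  PiTensorProduct.ext (MultilinearMap.ext h)

theorem contract_appendRight (x y : H) (n : ℕ) (h : ⨂[ℂ]^n H) :
    contract x n (appendRight y n h) = inner ℂ x y • h := by
  suffices e : contract x n ∘ₗ appendRight y n = inner ℂ x y • LinearMap.id from
    LinearMap.congr_fun e h
  refine tensor_ext fun v => ?_
  simp [appendRight_tprod]

theorem innerTensor_appendRight (x : H) (n : ℕ) (f : ⨂[ℂ]^n H) (t : ⨂[ℂ]^(n + 1) H) :
    innerTensor (n + 1) (appendRight x n f) t = innerTensor n f (contract x n t) := by
  induction f using PiTensorProduct.induction_on with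
  | smul_tprod r v =>
    suffices e : innerTensor (n + 1) (appendRight x n (PiTensorProduct.tprod ℂ v)) =
        innerTensor n (PiTensorProduct.tprod ℂ v) ∘ₗ contract x n by
      rw [map_smul, map_smulₛₗ, map_smulₛₗ, LinearMap.smul_apply, LinearMap.smul_apply, e]
      rfl
    refine tensor_ext fun w => ?_
    rw [appendRight_tprod, innerTensor_tprod, LinearMap.comp_apply, contract_tprod, map_smul,
      innerTensor_tprod, Fin.prod_univ_castSucc]
    simp [Fin.init, mul_comm]
  | add f g hf hg => simp only [map_add, LinearMap.add_apply, hf, hg]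

/-- Finitely many vectors occur in the last factor, and an orthonormal basis of their span resolves
the identity there. Allowing every larger `W` makes the property stable under sums, since two
tensors can then share one subspace. -/
theorem exists_expansion {n : ℕ} (t : ⨂[ℂ]^(n + 1) H) :
    ∃ V : Submodule ℂ H, FiniteDimensional ℂ V ∧ ∀ (W : Submodule ℂ H) [FiniteDimensional ℂ W],
      V ≤ W → ∑ i, appendRight (stdOrthonormalBasis ℂ W i : H) n
        (contract (stdOrthonormalBasis ℂ W i : H) n t) = t := by
  induction t using PiTensorProduct.induction_on with
  | smul_tprod r v =>
    refine ⟨ℂ ∙ v (Fin.last n), inferInstance, fun W _ hW => ?_⟩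
    have hw : v (Fin.last n) ∈ W := hW (Submodule.mem_span_singleton_self _)
    have e : r • PiTensorProduct.tprod ℂ v = appendRight (v (Fin.last n)) n
        (r • PiTensorProduct.tprod ℂ (Fin.init (α := fun _ => H) v)) := by
      rw [map_smul, appendRight_tprod, Fin.snoc_init_self]
    have h1 : ((_ : W) : H) = v (Fin.last n) := congrArg Subtype.val
      ((stdOrthonormalBasis ℂ W).sum_repr' ⟨v (Fin.last n), hw⟩)
    rw [e]
    generalize r • PiTensorProduct.tprod ℂ (Fin.init (α := fun _ => H) v) = h
    simp only [contract_appendRight, map_smul]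
    conv_rhs => rw [← h1]
    simp [appendRight, LinearMap.flip_apply, map_sum]
  | add s t hs ht =>
    obtain ⟨V₁, _, h₁⟩ := hs
    obtain ⟨V₂, _, h₂⟩ := ht
    refine ⟨V₁ ⊔ V₂, inferInstance, fun W _ hW => ?_⟩
    simp only [map_add, Finset.sum_add_distrib]
    rw [h₁ W (le_sup_left.trans hW), h₂ W (le_sup_right.trans hW)]

/-- Contraction is adjoint to `appendRight`, so all contractions of `t` are orthogonal to everything
and vanish by induction; the expansion rebuilds `t` from them. No completeness or closure enters. -/
theorem innerTensor_nondegenerate {n : ℕ} {t : ⨂[ℂ]^n H} (h : ∀ f, innerTensor n f t = 0) :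
    t = 0 := by
  induction n with
  | zero =>
    have h1 := (PiTensorProduct.isEmptyEquiv (R := ℂ) (s := fun _ : Fin 0 => H)
      (Fin 0)).symm_apply_apply t
    rw [PiTensorProduct.isEmptyEquiv_symm_apply] at h1
    rw [← h1] at h ⊢
    have h2 := h (PiTensorProduct.tprod ℂ isEmptyElim)
    rw [map_smul, innerTensor_tprod, Finset.univ_eq_empty, Finset.prod_empty, smul_eq_mul,
      mul_one] at h2
    rw [h2, zero_smul]
  | succ n ih =>
    obtain ⟨V, _, hV⟩ := exists_expansion t
    rw [← hV V le_rfl]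
    refine Finset.sum_eq_zero fun i _ => ?_
    have h0 : contract (stdOrthonormalBasis ℂ V i : H) n t = 0 :=
      ih fun f => by rw [← innerTensor_appendRight, h]
    rw [h0, map_zero]

end Contraction

/-! ### Contraction and the action of `Σ(n)` -/

section Action

variable {H : Type*} [NormedAddCommGroup H] [InnerProductSpace ℂ H] (J : H →ₗ[ℂ] H)

theorem embed_inv_castSucc {n : ℕ} (σ : hyperoctahedral n) (i : Fin n) (t : ℤˣ) :
    (embed n σ).1⁻¹ (i.castSucc, t) = ((σ.1⁻¹ (i, t)).1.castSucc, (σ.1⁻¹ (i, t)).2) := by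
  have h : (embed n σ).1⁻¹ = (embed n σ⁻¹).1 := by rw [map_inv]; rfl
  rw [h, embed_castSucc]
  rfl

theorem embed_inv_last {n : ℕ} (σ : hyperoctahedral n) (t : ℤˣ) :
    (embed n σ).1⁻¹ (Fin.last n, t) = (Fin.last n, t) := by
  rw [Equiv.Perm.inv_eq_iff_eq, embed_last]

theorem contract_act_embed (x : H) {n : ℕ} (σ : hyperoctahedral n) (t : ⨂[ℂ]^(n + 1) H) :
    contract x n (act J (embed n σ) t) = act J σ (contract x n t) := by
  suffices e : contract x n ∘ₗ act J (embed n σ) = act J σ ∘ₗ contract x n from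
    LinearMap.congr_fun e t
  refine tensor_ext fun v => ?_
  rw [LinearMap.comp_apply, LinearMap.comp_apply, act_tprod, contract_tprod, contract_tprod,
    map_smul, act_tprod, embed_inv_last, if_pos rfl]
  congr 2
  funext k
  simp only [Fin.init, embed_inv_castSucc]

theorem act_embed_appendRight (y : H) {n : ℕ} (σ : hyperoctahedral n) (h : ⨂[ℂ]^n H) :
    act J (embed n σ) (appendRight y n h) = appendRight y n (act J σ h) := by
  suffices e : act J (embed n σ) ∘ₗ appendRight y n = appendRight y n ∘ₗ act J σ from
    LinearMap.congr_fun e h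
  refine tensor_ext fun v => ?_
  rw [LinearMap.comp_apply, LinearMap.comp_apply, act_tprod, appendRight_tprod, act_tprod,
    appendRight_tprod]
  congr 1
  funext k
  induction k using Fin.lastCases with
  | last => simp [embed_inv_last]
  | cast k => simp [embed_inv_castSucc]

/-- After the swap, `y` sits in the last place but one and the contraction meets the last factor of
`h`. This is the source of the term `q b*(y) b(x)`. -/
theorem contract_act_gen_last (x y : H) {n : ℕ} (h : ⨂[ℂ]^(n + 1) H) :
    contract x (n + 1) (act J (gen (Fin.last (n + 1))) (appendRight y (n + 1) h)) =
      appendRight y n (contract x n h) := by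
  suffices e : contract x (n + 1) ∘ₗ act J (gen (Fin.last (n + 1))) ∘ₗ appendRight y (n + 1) =
      appendRight y n ∘ₗ contract x n from LinearMap.congr_fun e h
  refine tensor_ext fun v => ?_
  have e1 : (⟨(Fin.last (n + 1)).val - 1, by omega⟩ : Fin (n + 2)) = (Fin.last n).castSucc := by
    ext; simp
  rw [LinearMap.comp_apply, LinearMap.comp_apply, LinearMap.comp_apply, appendRight_tprod,
    act_gen_pos J _ (by simp), contract_tprod, contract_tprod, map_smul, appendRight_tprod, e1,
    Equiv.swap_apply_right, Fin.snoc_castSucc]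
  congr 2
  funext k
  induction k using Fin.lastCases with
  | last => simp [Fin.init]
  | cast k =>
    rw [Fin.init, Equiv.swap_apply_of_ne_of_ne]
    · simp [Fin.init]
    · simp [Fin.ext_iff]; omega
    · simp [Fin.ext_iff]; omega

theorem contract_act_rep_last (x y : H) {n : ℕ} (h : ⨂[ℂ]^n H) :
    contract x n (act J (rep (Fin.last n, -1)) (appendRight y n h)) = inner ℂ x (J y) • h := by
  suffices e : contract x n ∘ₗ act J (rep (Fin.last n, -1)) ∘ₗ appendRight y n =
      inner ℂ x (J y) • LinearMap.id from LinearMap.congr_fun e h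
  have h1 : (rep (Fin.last n, -1)).1⁻¹ (Fin.last n, 1) = (Fin.last n, -1) := by
    rw [Equiv.Perm.inv_eq_iff_eq, rep_self]
  have h2 : ∀ k : Fin n, (rep (Fin.last n, -1)).1⁻¹ (k.castSucc, 1) = (k.castSucc, 1) := by
    intro k
    rw [Equiv.Perm.inv_eq_iff_eq, rep_apply]
    have hk := k.isLt
    ext
    · simp
    · dsimp only
      rw [if_neg (by simp; omega)]
  refine tensor_ext fun v => ?_
  rw [LinearMap.comp_apply, LinearMap.comp_apply, appendRight_tprod, act_tprod, contract_tprod, h1,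
    if_neg (show (-1 : ℤˣ) ≠ 1 by decide), Fin.snoc_last]
  rw [LinearMap.smul_apply, LinearMap.id_apply]
  congr 2
  funext k
  simp [Fin.init, h2]

variable {J} (hJ : ∀ x, J (J x) = x)

/-- The action of the group algebra of `Σ(n)` on `H^{⊗n}`. -/
def actAlg (n : ℕ) :
    MonoidAlgebra ℂ (hyperoctahedral n) →ₐ[ℂ] Module.End ℂ (⨂[ℂ]^n H) :=
  MonoidAlgebra.lift ℂ (Module.End ℂ (⨂[ℂ]^n H)) (hyperoctahedral n)
    { toFun := act J
      map_one' := act_one J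
      map_mul' := act_mul J hJ }

@[simp]
theorem actAlg_of {n : ℕ} (σ : hyperoctahedral n) :
    actAlg hJ n (MonoidAlgebra.of ℂ _ σ) = act J σ :=
  MonoidAlgebra.lift_of _ _

theorem symmetrization_eq (α q : ℝ) (n : ℕ) :
    symmetrization α q J n = actAlg hJ n (symElement α q n) := by
  rw [symmetrization, symElement, map_sum]
  exact Finset.sum_congr rfl fun σ _ => by rw [map_smul, actAlg_of]

theorem contract_actAlg_embedAlg (x : H) {n : ℕ} (a : MonoidAlgebra ℂ (hyperoctahedral n))
    (t : ⨂[ℂ]^(n + 1) H) :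
    contract x n (actAlg hJ (n + 1) (embedAlg n a) t) = actAlg hJ n a (contract x n t) := by
  induction a using MonoidAlgebra.induction_on with
  | of σ => rw [embedAlg_of, actAlg_of, actAlg_of, contract_act_embed]
  | add a b ha hb => simp only [map_add, LinearMap.add_apply, ha, hb]
  | smul c a ha => simp only [map_smul, LinearMap.smul_apply, ha]

theorem actAlg_embedAlg_appendRight (y : H) {n : ℕ} (a : MonoidAlgebra ℂ (hyperoctahedral n))
    (h : ⨂[ℂ]^n H) :
    actAlg hJ (n + 1) (embedAlg n a) (appendRight y n h) =
      appendRight y n (actAlg hJ n a h) := by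
  induction a using MonoidAlgebra.induction_on with
  | of σ => rw [embedAlg_of, actAlg_of, actAlg_of, act_embed_appendRight]
  | add a b ha hb => simp only [map_add, LinearMap.add_apply, ha, hb]
  | smul c a ha => simp only [map_smul, LinearMap.smul_apply, ha]

/-- Contraction commutes with `Σ(n)`, so the left factor of `P^{(n+1)} = P^{(n)} R_n` comes out.
What remains next to the contraction is the annihilation operator. -/
theorem symmetrization_succ (α q : ℝ) (x : H) (n : ℕ) (t : ⨂[ℂ]^(n + 1) H) :
    contract x n (symmetrization α q J (n + 1) t) =
      symmetrization α q J n (contract x n (actAlg hJ (n + 1) (cosetElement α q n) t)) := by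
  rw [symmetrization_eq hJ, symmetrization_eq hJ, symElement_succ, map_mul, Module.End.mul_apply,
    contract_actAlg_embedAlg]

theorem symmetrization_injective (hJ : ∀ x, J (J x) = x) {α q : ℝ} (hα : α ∈ Set.Ioo (-1 : ℝ) 1)
    (hq : q ∈ Set.Ioo (-1 : ℝ) 1) (n : ℕ) : Function.Injective (symmetrization α q J n) := by
  have h : ∀ r ∈ Set.Ioo (-1 : ℝ) 1, ‖(r : ℂ)‖ < 1 := fun r hr => by
    rw [Complex.norm_real, Real.norm_eq_abs, abs_lt]
    exact hr
  rw [symmetrization_eq hJ]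
  exact ((Module.End.isUnit_iff _).1 ((isUnit_symElement (h α hα) (h q hq) n).map _)).1

end Action

/-! ### The annihilation operators -/

section Annihilation

variable {H : Type*} [NormedAddCommGroup H] [InnerProductSpace ℂ H] {J : H →ₗ[ℂ] H}

theorem innerFock_lof (α q : ℝ) (J : H →ₗ[ℂ] H) (f : Fock H) (n : ℕ) (g : ⨂[ℂ]^n H) :
    innerFock α q J f (DirectSum.lof ℂ ℕ (fun m : ℕ => ⨂[ℂ]^m H) n g) =
      innerTensor n (f n) (symmetrization α q J n g) := by
  rw [innerFock, DirectSum.toModule_lof]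
  rfl

theorem creation_lof (x : H) (n : ℕ) (f : ⨂[ℂ]^n H) :
    creation x (DirectSum.lof ℂ ℕ (fun m : ℕ => ⨂[ℂ]^m H) n f) =
      DirectSum.lof ℂ ℕ (fun m : ℕ => ⨂[ℂ]^m H) (n + 1) (appendRight x n f) := by
  rw [creation, DirectSum.toModule_lof]
  rfl

theorem creation_apply_zero (x : H) (f : Fock H) : creation x f 0 = 0 := by
  induction f using DirectSum.induction_on with
  | zero => rw [map_zero]; rfl
  | of n f =>
    rw [← DirectSum.lof_eq_of ℂ, creation_lof]
    exact DirectSum.of_eq_of_ne _ _ _ (Nat.succ_ne_zero n).symm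
  | add f g hf hg => rw [map_add, DirectSum.add_apply, hf, hg, add_zero]

theorem creation_apply_succ (x : H) (f : Fock H) (n : ℕ) :
    creation x f (n + 1) = appendRight x n (f n) := by
  induction f using DirectSum.induction_on with
  | zero => rw [map_zero, DirectSum.zero_apply, DirectSum.zero_apply, map_zero]
  | of m f =>
    rw [← DirectSum.lof_eq_of ℂ, creation_lof]
    by_cases h : m = n
    · subst h
      rw [DirectSum.lof_apply, DirectSum.lof_apply]
    · rw [DirectSum.lof_eq_of, DirectSum.lof_eq_of,
        DirectSum.of_eq_of_ne _ _ _ (fun e => h (by omega)),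
        DirectSum.of_eq_of_ne _ _ _ (fun e => h (by omega)), map_zero]
  | add f g hf hg => rw [map_add, DirectSum.add_apply, hf, hg, DirectSum.add_apply, map_add]

/-- The annihilation operator on `H^{⊗n}`. -/
def annihilationAux (hJ : ∀ x, J (J x) = x) (α q : ℝ) (x : H) :
    (n : ℕ) → (⨂[ℂ]^n H) →ₗ[ℂ] Fock H
  | 0 => 0
  | n + 1 => DirectSum.lof ℂ ℕ (fun m : ℕ => ⨂[ℂ]^m H) n ∘ₗ contract x n ∘ₗ
      actAlg hJ (n + 1) (cosetElement α q n)

/-- The annihilation operator. -/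
def annihilation (hJ : ∀ x, J (J x) = x) (α q : ℝ) (x : H) : Fock H →ₗ[ℂ] Fock H :=
  DirectSum.toModule ℂ ℕ (Fock H) (annihilationAux hJ α q x)

theorem annihilation_lof (hJ : ∀ x, J (J x) = x) (α q : ℝ) (x : H) (n : ℕ) (g : ⨂[ℂ]^n H) :
    annihilation hJ α q x (DirectSum.lof ℂ ℕ (fun m : ℕ => ⨂[ℂ]^m H) n g) =
      annihilationAux hJ α q x n g := by
  rw [annihilation, DirectSum.toModule_lof]

theorem isAnnihilation_annihilation (hJ : ∀ x, J (J x) = x) (α q : ℝ) (x : H) :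
    IsAnnihilation α q J x (annihilation hJ α q x) := by
  intro f g
  induction g using DirectSum.induction_on with
  | zero => simp [innerFock]
  | of n g =>
    rw [← DirectSum.lof_eq_of ℂ, innerFock_lof, annihilation_lof]
    cases n with
    -- A created vector has no vacuum component, which matches the value `0` of the annihilation
    -- operator on degree zero.
    | zero => simp [creation_apply_zero, annihilationAux, innerFock]
    | succ n =>
      rw [creation_apply_succ, innerTensor_appendRight, symmetrization_succ hJ, annihilationAux,
        LinearMap.comp_apply, LinearMap.comp_apply, innerFock_lof]
  | add g h hg hh =>
    simp only [innerFock, map_add] at hg hh ⊢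
    rw [hg, hh]

theorem innerFock_eq_lof {α q : ℝ} (f : Fock H) (n : ℕ) (h : ⨂[ℂ]^n H) :
    innerFock α q J (DirectSum.lof ℂ ℕ (fun m : ℕ => ⨂[ℂ]^m H) n h) f =
      innerTensor n h (symmetrization α q J n (f n)) := by
  induction f using DirectSum.induction_on with
  | zero => simp [innerFock]
  | of m f =>
    rw [← DirectSum.lof_eq_of ℂ, innerFock_lof]
    by_cases hm : m = n
    · subst hm
      rw [DirectSum.lof_apply, DirectSum.lof_apply]
    · rw [DirectSum.lof_eq_of, DirectSum.lof_eq_of, DirectSum.of_eq_of_ne _ _ _ hm,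
        DirectSum.of_eq_of_ne _ _ _ (Ne.symm hm)]
      simp
  | add f g hf hg =>
    rw [DirectSum.add_apply, map_add, map_add, ← hf, ← hg]
    simp only [innerFock, map_add]

/-- The form `⟨·, ·⟩_{α, q}` is nondegenerate. -/
theorem innerFock_nondegenerate (hJ : ∀ x, J (J x) = x) {α q : ℝ} (hα : α ∈ Set.Ioo (-1 : ℝ) 1)
    (hq : q ∈ Set.Ioo (-1 : ℝ) 1) {g : Fock H} (h : ∀ f, innerFock α q J f g = 0) : g = 0 := by
  refine DFinsupp.ext fun n => symmetrization_injective hJ hα hq n ?_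
  rw [innerTensor_nondegenerate (t := symmetrization α q J n (g n)) fun f => by
    rw [← innerFock_eq_lof, h]]
  exact (map_zero _).symm

theorem IsAnnihilation.eq (hJ : ∀ x, J (J x) = x) {α q : ℝ} (hα : α ∈ Set.Ioo (-1 : ℝ) 1)
    (hq : q ∈ Set.Ioo (-1 : ℝ) 1) {x : H} {b b' : Fock H →ₗ[ℂ] Fock H}
    (hb : IsAnnihilation α q J x b) (hb' : IsAnnihilation α q J x b') : b = b' := by
  refine LinearMap.ext fun g => sub_eq_zero.1 (innerFock_nondegenerate hJ hα hq fun f => ?_)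
  have h : innerFock α q J f (b g - b' g) = innerFock α q J f (b g) - innerFock α q J f (b' g) := by
    simp only [innerFock, map_sub]
  rw [h, ← hb, ← hb', sub_self]

/-- Contracting the recursion of the coset sum on `g ⊗ y` gives the relation term by term. In degree
zero the middle term is absent, and `π₀` itself is the sign change of the last point. -/
theorem annihilation_comp_creation (hJ : ∀ x, J (J x) = x) (α q : ℝ) (x y : H) :
    annihilation hJ α q x ∘ₗ creation y - (q : ℂ) • (creation y ∘ₗ annihilation hJ α q x) =
      inner ℂ x y • LinearMap.id + ((α : ℂ) * inner ℂ x (J y)) • qPowTwoN q := by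
  refine DirectSum.linearMap_ext _ fun n => LinearMap.ext fun g => ?_
  simp only [LinearMap.comp_apply, LinearMap.sub_apply, LinearMap.add_apply, LinearMap.smul_apply,
    LinearMap.id_apply, creation_lof, annihilation_lof, qPowTwoN, functionOfNumber,
    DirectSum.lmap_lof]
  rw [annihilationAux, LinearMap.comp_apply, LinearMap.comp_apply]
  cases n with
  | zero =>
    have h0 : gen (0 : Fin 1) = rep (Fin.last 0, -1) := rep_zero_neg_one.symm
    rw [cosetElement_zero, h0, map_add, map_one, map_smul, actAlg_of, LinearMap.add_apply,
      LinearMap.smul_apply, map_add, map_smul, contract_act_rep_last, Module.End.one_apply,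
      contract_appendRight]
    simp [annihilationAux, smul_smul]
  | succ n =>
    rw [cosetElement_succ, map_add, map_add, map_one, map_smul, map_smul, actAlg_of, map_mul,
      actAlg_of]
    simp only [LinearMap.add_apply, LinearMap.smul_apply, map_add, map_smul]
    rw [contract_act_rep_last, Module.End.one_apply, contract_appendRight, Module.End.mul_apply,
      actAlg_embedAlg_appendRight, contract_act_gen_last]
    simp only [annihilationAux, LinearMap.comp_apply, creation_lof, map_smul, smul_smul]
    rw [show (α : ℂ) * q ^ (2 * (n + 1)) * inner ℂ x (J y) =
      α * inner ℂ x (J y) * q ^ (2 * (n + 1)) by ring]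
    abel

end Annihilation

end

end TypeBFock

theorem mainTheorem3 {H : Type*} [NormedAddCommGroup H] [InnerProductSpace ℂ H] [CompleteSpace H]
    (J : H →ₗ[ℂ] H) (hJ_symm : J.IsSymmetric) (hJ_inv : ∀ x, J (J x) = x)
    (α q : ℝ) (hα : α ∈ Set.Ioo (-1 : ℝ) 1) (hq : q ∈ Set.Ioo (-1 : ℝ) 1) :
    (∀ x : H, ∃! b : TypeBFock.Fock H →ₗ[ℂ] TypeBFock.Fock H,
      TypeBFock.IsAnnihilation α q J x b) ∧
    ∀ (x y : H) (b : TypeBFock.Fock H →ₗ[ℂ] TypeBFock.Fock H),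
      TypeBFock.IsAnnihilation α q J x b →
        b ∘ₗ TypeBFock.creation y - (q : ℂ) • (TypeBFock.creation y ∘ₗ b) =
          inner ℂ x y • LinearMap.id +
            ((α : ℂ) * inner ℂ x (J y)) • TypeBFock.qPowTwoN q := by
  refine ⟨fun x => ⟨TypeBFock.annihilation hJ_inv α q x,
    TypeBFock.isAnnihilation_annihilation hJ_inv α q x,
    fun b hb => hb.eq hJ_inv hα hq (TypeBFock.isAnnihilation_annihilation hJ_inv α q x)⟩,
    fun x y b hb => ?_⟩
  rw [hb.eq hJ_inv hα hq (TypeBFock.isAnnihilation_annihilation hJ_inv α q x)]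
  exact TypeBFock.annihilation_comp_creation hJ_inv α q x y
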